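/- Let $p_1,p_2,p_3$ be the vertices of an equilateral triangle in $\mathbb{R}^2$, let $\varphi_i(x)=\tfrac12x+\tfrac12p_i$, and let $K$ be the Sierpinski gasket, i.e. the unique nonempty compact set with $K=\bigcup_{i=1}^3\varphi_i(K)$. For $u\in C(K,\mathbb{R})$ put $$\mathcal{E}(u)=\lim_{n\to\infty}\Big(\tfrac53\Big)^n\sum_{x\sim_n y}(u(x)-u(y))^2$$ (an increasing limit), the sum being over the edges of the $n$-th approximating graph, whose edges are the pairs $\{\varphi_w(p_i),\varphi_w(p_j)\}$, $i\neq j$, $\varphi_w=\varphi_{w_1}\circ\dots\circ\varphi_{w_n}$. Let $\mathcal{F}=\{u\in C(K,\mathbb{R}):\mathcal{E}(u)<\infty\}$, let $\mathcal{E}(u,v)$ be the polarized form, and let $\mathcal{F}_{\mathbb{C}}=\mathcal{F}+i\mathcal{F}$. For $f\in\mathcal{F}$ let $\nu_f$ be its energy measure on $K$, i.e. the finite Borel measure with $\int_K\phi\,d\nu_f=\lim_n\sum_{|w|=n}\phi(\varphi_w(p_1))\,(\tfrac53)^n\mathcal{E}(f\circ\varphi_w)$ for all $\phi\in C(K)$,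 and let $\nu_{f,g}=\tfrac14(\nu_{f+g}-\nu_{f-g})$. A function in $\mathcal F$ is harmonic if it minimizes $\mathcal{E}$ among all functions in $\mathcal F$ with the same values at $p_1,p_2,p_3$. Let $\{h_1,h_2\}$ be any complete $\mathcal{E}$-orthonormal system for the space of harmonic functions modulo constants, let $\nu=\nu_{h_1}+\nu_{h_2}$ be the Kusuoka measure, and let $\Gamma(f,g)=d\nu_{f,g}/d\nu$, extended to $f,g\in\mathcal{F}_{\mathbb{C}}$ so that it is linear in $f$ and conjugate linear in $g$. Let $\mathcal{H}_{\mathbb{C}}$ be the Hilbert space of $1$-forms obtained from $\mathcal{F}_{\mathbb{C}}\otimes\mathcal{F}_{\mathbb{C}}$ with $$\langle a\otimes b,c\otimes d\rangle_{\mathcal{H}}=\int_K b\,\overline{d}\,\Gamma(a,c)\,d\nu$$ by factoring out the elements of zero norm and completing. Then $\mathcal{F}_{\mathbb{C}}$ embeds injectively into $L^2_{\mathbb{C}}(K,\nu)$, so that $\partial f=f\otimes\mathbf{1}$, $\operatorname{dom}\partial=\mathcal{F}_{\mathbb{C}}$, is a well-defined unbounded operator from $L^2_{\mathbb{C}}(K,\nu)$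 to $\mathcal{H}_{\mathbb{C}}$. Let $\partial^*$ be the divergence, i.e. minus the Hilbert space adjoint of $\partial$: $v\in\operatorname{dom}\partial^*$ and $\partial^*v=v^*$ iff $v^*\in L^2_{\mathbb{C}}(K,\nu)$ satisfies $\langle v^*,u\rangle_{L^2(K,\nu)}=-\langle v,\partial u\rangle_{\mathcal{H}}$ for all $u\in\mathcal{F}_{\mathbb{C}}$. Then the Dirac operator $D$ on $L^2_{\mathbb{C}}(K,\nu)\oplus\mathcal{H}_{\mathbb{C}}$ with domain $\operatorname{dom}D=\mathcal{F}_{\mathbb{C}}\oplus\operatorname{dom}\partial^*$, $$D(f,\omega)=(-i\,\partial^*\omega,\,-i\,\partial f),$$ is self-adjoint. -/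

import Mathlib

noncomputable section

namespace SierpinskiGasket

open MeasureTheory Filter Topology TopologicalSpace
open scoped ENNReal NNReal TensorProduct ComplexConjugate

/-- The Euclidean plane. -/
abbrev Plane := EuclideanSpace ℝ (Fin 2)

/-! ### The gasket -/

/-- The similarity `φ_i(x) = x / 2 + p_i / 2`, where `p_i` are the vertices of the triangle `T`. -/
def phi (T : Affine.Triangle ℝ Plane) (i : Fin 3) (x : Plane) : Plane :=
  (1 / 2 : ℝ) • x + (1 / 2 : ℝ) • T.points i

lemma phi_dist (T : Affine.Triangle ℝ Plane) (i : Fin 3) (x y : Plane) :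
    dist (phi T i x) (phi T i y) = (1 / 2 : ℝ) * dist x y := by
  simp only [phi, dist_add_right, dist_smul₀]
  norm_num

lemma phi_lipschitz (T : Affine.Triangle ℝ Plane) (i : Fin 3) :
    LipschitzWith (1 / 2) (phi T i) :=
  LipschitzWith.of_dist_le_mul fun x y => by rw [phi_dist]; simp

/-- The Hutchinson operator `A ↦ φ_1 A ∪ φ_2 A ∪ φ_3 A` on nonempty compact sets. -/
def hutchinson (T : Affine.Triangle ℝ Plane) (A : NonemptyCompacts Plane) :
    NonemptyCompacts Plane where
  carrier := ⋃ i : Fin 3, phi T i '' (A : Set Plane)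
  isCompact' := isCompact_iUnion fun i => A.isCompact.image (phi_lipschitz T i).continuous
  nonempty' := Set.nonempty_iUnion.2 ⟨0, A.nonempty.image _⟩

lemma hutchinson_contracting (T : Affine.Triangle ℝ Plane) :
    ContractingWith (1 / 2) (hutchinson T) := by
  refine ⟨by norm_num [← NNReal.coe_lt_coe], fun A B => ?_⟩
  change Metric.hausdorffEDist (⋃ i : Fin 3, phi T i '' (A : Set Plane))
    (⋃ i : Fin 3, phi T i '' (B : Set Plane)) ≤ _ * Metric.hausdorffEDist (A : Set Plane) B
  refine Metric.hausdorffEDist_iUnion_le.trans (iSup_le fun i => ?_)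
  have key : ∀ A B : NonemptyCompacts Plane, ∀ x ∈ phi T i '' (A : Set Plane),
      ∃ y ∈ phi T i '' (B : Set Plane), edist x y ≤
        ((1 / 2 : ℝ≥0) : ℝ≥0∞) * Metric.hausdorffEDist (A : Set Plane) B := by
    rintro A B _ ⟨a, ha, rfl⟩
    obtain ⟨b, hb, hab⟩ := B.isCompact.exists_infEDist_eq_edist B.nonempty a
    refine ⟨_, ⟨b, hb, rfl⟩, (phi_lipschitz T i a b).trans ?_⟩
    gcongr
    rw [← hab]
    exact Metric.infEDist_le_hausdorffEDist_of_mem ha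
  refine Metric.hausdorffEDist_le_of_mem_edist (key A B) ?_
  rw [Metric.hausdorffEDist_comm]
  exact key B A

instance : Nonempty (NonemptyCompacts Plane) := ⟨{0}⟩

/-- The Sierpinski gasket as a subset of the plane: the unique nonempty compact set `K` with
`K = φ_1 K ∪ φ_2 K ∪ φ_3 K`. -/
def gasketSet (T : Affine.Triangle ℝ Plane) : NonemptyCompacts Plane :=
  ContractingWith.fixedPoint (hutchinson T) (hutchinson_contracting T)

lemma gasketSet_eq (T : Affine.Triangle ℝ Plane) :
    (gasketSet T : Set Plane) = ⋃ i : Fin 3, phi T i '' (gasketSet T : Set Plane) :=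
  congrArg (fun A : NonemptyCompacts Plane => (A : Set Plane))
    (hutchinson_contracting T).fixedPoint_isFixedPt.symm

lemma gasketSet_unique (T : Affine.Triangle ℝ Plane) {A : Set Plane} (hA : IsCompact A)
    (hne : A.Nonempty) (h : A = ⋃ i : Fin 3, phi T i '' A) : A = gasketSet T :=
  congrArg (fun A : NonemptyCompacts Plane => (A : Set Plane))
    ((hutchinson_contracting T).fixedPoint_unique (x := ⟨⟨A, hA⟩, hne⟩)
      (NonemptyCompacts.ext h.symm))

attribute [irreducible] gasketSet

lemma phi_mem (T : Affine.Triangle ℝ Plane) (i : Fin 3) {x : Plane} (hx : x ∈ gasketSet T) :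
    phi T i x ∈ gasketSet T := by
  have : phi T i x ∈ (gasketSet T : Set Plane) := by
    rw [gasketSet_eq]
    exact Set.mem_iUnion.2 ⟨i, x, hx, rfl⟩
  exact this

lemma phi_vertex (T : Affine.Triangle ℝ Plane) (i : Fin 3) :
    phi T i (T.points i) = T.points i := by
  rw [phi, ← add_smul]; norm_num

lemma phi_vertex_comm (T : Affine.Triangle ℝ Plane) (i j : Fin 3) :
    phi T i (T.points j) = phi T j (T.points i) := by
  rw [phi, phi, add_comm]

lemma vertex_mem (T : Affine.Triangle ℝ Plane) (i : Fin 3) : T.points i ∈ gasketSet T := by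
  obtain ⟨y, hy, hmin⟩ := (gasketSet T).isCompact.exists_infDist_eq_dist (gasketSet T).nonempty
    (T.points i)
  have h1 : Metric.infDist (T.points i) (gasketSet T : Set Plane) ≤ dist (T.points i) (phi T i y) :=
    Metric.infDist_le_dist_of_mem (phi_mem T i hy)
  have h2 : dist (T.points i) (phi T i y) = 1 / 2 * dist (T.points i) y := by
    conv_lhs => rw [← phi_vertex T i]
    exact phi_dist T i _ _
  have h3 : dist (T.points i) y ≤ 0 := by linarith
  have : T.points i = y := dist_le_zero.1 h3
  rw [this]; exact hy

/-- The Sierpinski gasket `K` as a compact metric space. -/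
abbrev Gasket (T : Affine.Triangle ℝ Plane) : Type := ↥(gasketSet T)

instance (T : Affine.Triangle ℝ Plane) : CompactSpace (Gasket T) :=
  isCompact_iff_compactSpace.1 (gasketSet T).isCompact

/-- The contractions `φ_i` as maps `K → K`. -/
def contraction (T : Affine.Triangle ℝ Plane) (i : Fin 3) (x : Gasket T) : Gasket T :=
  ⟨phi T i x, phi_mem T i x.2⟩

/-- The boundary vertices `p_i`, as points of `K`. -/
def vertex (T : Affine.Triangle ℝ Plane) (i : Fin 3) : Gasket T := ⟨T.points i, vertex_mem T i⟩

/-- The map `φ_w = φ_{w_0} ∘ ⋯ ∘ φ_{w_{n-1}}` attached to a word `w` of length `n`. -/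
def cellMap (T : Affine.Triangle ℝ Plane) : (n : ℕ) → (Fin n → Fin 3) → Gasket T → Gasket T
  | 0, _, x => x
  | n + 1, w, x => contraction T (w 0) (cellMap T n (fun k => w k.succ) x)


/-! ### The standard self-similar energy form -/

/-- The discrete energy `E_n(u) = (5/3)^n ∑_{x ~ y} (u(x) - u(y))^2`. The edges of the `n`-th
approximating graph are the pairs `φ_w p_i, φ_w p_j` with `i < j` and `w` a word of length `n`,
each edge lying in exactly one cell. -/
def discreteEnergy (T : Affine.Triangle ℝ Plane) (n : ℕ) (u : Gasket T → ℝ) : ℝ :=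
  (5 / 3 : ℝ) ^ n * ∑ w : Fin n → Fin 3, ∑ i : Fin 3, ∑ j ∈ Finset.Ioi i,
    (u (cellMap T n w (vertex T i)) - u (cellMap T n w (vertex T j))) ^ 2

/-- The energy `E(u) = lim_n E_n(u)`; the sequence is increasing, so this is its supremum. It is
only used for functions whose discrete energies are bounded. -/
def energy (T : Affine.Triangle ℝ Plane) (u : Gasket T → ℝ) : ℝ := ⨆ n, discreteEnergy T n u

/-- `u` has finite energy. -/
def FiniteEnergy (T : Affine.Triangle ℝ Plane) (u : Gasket T → ℝ) : Prop :=
  BddAbove (Set.range fun n => discreteEnergy T n u)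

lemma sum_words {M : Type*} [AddCommMonoid M] (n : ℕ) (F : (Fin (n + 1) → Fin 3) → M) :
    ∑ w, F w = ∑ i : Fin 3, ∑ w : Fin n → Fin 3, F (Fin.cons i w) := by
  rw [← Fintype.sum_prod_type' (f := fun i (w : Fin n → Fin 3) => F (Fin.cons i w))]
  exact ((Fin.consEquiv (fun _ : Fin (n + 1) => Fin 3)).sum_comp F).symm

lemma cellMap_cons (T : Affine.Triangle ℝ Plane) (n : ℕ) (i : Fin 3) (w : Fin n → Fin 3)
    (x : Gasket T) :
    cellMap T (n + 1) (Fin.cons i w) x = contraction T i (cellMap T n w x) := by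
  simp [cellMap]

lemma discreteEnergy_succ (T : Affine.Triangle ℝ Plane) (n : ℕ) (u : Gasket T → ℝ) :
    discreteEnergy T (n + 1) u =
      (5 / 3 : ℝ) * ∑ i, discreteEnergy T n (fun x => u (contraction T i x)) := by
  simp only [discreteEnergy, sum_words, cellMap_cons, ← Finset.mul_sum]
  ring

lemma discreteEnergy_zero (T : Affine.Triangle ℝ Plane) (u : Gasket T → ℝ) :
    discreteEnergy T 0 u = (u (vertex T 0) - u (vertex T 1)) ^ 2 +
      (u (vertex T 0) - u (vertex T 2)) ^ 2 + (u (vertex T 1) - u (vertex T 2)) ^ 2 := by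
  have h0 : (Finset.Ioi (0 : Fin 3)) = {1, 2} := by decide
  have h1 : (Finset.Ioi (1 : Fin 3)) = {2} := by decide
  have h2 : (Finset.Ioi (2 : Fin 3)) = ∅ := by decide
  simp [discreteEnergy, cellMap, Fin.sum_univ_three, h0, h1, h2]

lemma discreteEnergy_nonneg (T : Affine.Triangle ℝ Plane) (n : ℕ) (u : Gasket T → ℝ) :
    0 ≤ discreteEnergy T n u := by
  unfold discreteEnergy; positivity

lemma contraction_vertex (T : Affine.Triangle ℝ Plane) (i : Fin 3) :
    contraction T i (vertex T i) = vertex T i := Subtype.ext (phi_vertex T i)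

lemma contraction_vertex_comm (T : Affine.Triangle ℝ Plane) (i j : Fin 3) :
    contraction T i (vertex T j) = contraction T j (vertex T i) :=
  Subtype.ext (phi_vertex_comm T i j)

lemma discreteEnergy_le_succ (T : Affine.Triangle ℝ Plane) (n : ℕ) :
    ∀ u : Gasket T → ℝ, discreteEnergy T n u ≤ discreteEnergy T (n + 1) u := by
  induction n with
  | zero =>
    intro u
    rw [discreteEnergy_succ, Fin.sum_univ_three]
    simp only [discreteEnergy_zero, contraction_vertex]
    rw [contraction_vertex_comm T 1 0, contraction_vertex_comm T 2 0,
      contraction_vertex_comm T 2 1]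
    generalize u (vertex T 0) = a
    generalize u (vertex T 1) = b
    generalize u (vertex T 2) = c
    generalize u (contraction T 0 (vertex T 1)) = x
    generalize u (contraction T 0 (vertex T 2)) = y
    generalize u (contraction T 1 (vertex T 2)) = z
    nlinarith [sq_nonneg (x - (2 * a + 2 * b + c) / 5), sq_nonneg (y - (2 * a + 2 * c + b) / 5),
      sq_nonneg (z - (2 * b + 2 * c + a) / 5),
      sq_nonneg ((x - (2 * a + 2 * b + c) / 5) - (y - (2 * a + 2 * c + b) / 5)),
      sq_nonneg ((x - (2 * a + 2 * b + c) / 5) - (z - (2 * b + 2 * c + a) / 5)),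
      sq_nonneg ((y - (2 * a + 2 * c + b) / 5) - (z - (2 * b + 2 * c + a) / 5))]
  | succ n ih =>
    intro u
    rw [discreteEnergy_succ, discreteEnergy_succ T (n + 1)]
    gcongr with i _
    exact ih _

lemma discreteEnergy_mono (T : Affine.Triangle ℝ Plane) (u : Gasket T → ℝ) :
    Monotone fun n => discreteEnergy T n u :=
  monotone_nat_of_le_succ fun n => discreteEnergy_le_succ T n u

variable {T : Affine.Triangle ℝ Plane}

lemma FiniteEnergy.tendsto {u : Gasket T → ℝ} (hu : FiniteEnergy T u) :
    Tendsto (fun n => discreteEnergy T n u) atTop (𝓝 (energy T u)) :=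
  tendsto_atTop_ciSup (discreteEnergy_mono T u) hu

lemma finiteEnergy_of_tendsto_le {u : Gasket T → ℝ} {g : ℕ → ℝ} {c : ℝ}
    (hg : Tendsto g atTop (𝓝 c)) (h : ∀ n, discreteEnergy T n u ≤ g n) : FiniteEnergy T u := by
  obtain ⟨C, hC⟩ := hg.bddAbove_range
  refine ⟨C, ?_⟩
  rintro _ ⟨n, rfl⟩
  exact (h n).trans (hC ⟨n, rfl⟩)

lemma energy_nonneg (u : Gasket T → ℝ) : 0 ≤ energy T u :=
  Real.iSup_nonneg fun n => discreteEnergy_nonneg T n u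

lemma finiteEnergy_const (c : ℝ) : FiniteEnergy T (fun _ => c) := by
  refine ⟨0, ?_⟩
  rintro _ ⟨n, rfl⟩
  simp [discreteEnergy]

lemma FiniteEnergy.add {u v : Gasket T → ℝ} (hu : FiniteEnergy T u) (hv : FiniteEnergy T v) :
    FiniteEnergy T (u + v) := by
  refine finiteEnergy_of_tendsto_le ((hu.tendsto.const_mul 2).add (hv.tendsto.const_mul 2)) ?_
  intro n
  simp only [discreteEnergy, Finset.mul_sum, ← Finset.sum_add_distrib, Pi.add_apply]
  gcongr with w _ i _ j _
  have : (0 : ℝ) < (5 / 3) ^ n := by positivity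
  nlinarith [mul_nonneg this.le (sq_nonneg ((u (cellMap T n w (vertex T i)) -
    u (cellMap T n w (vertex T j))) - (v (cellMap T n w (vertex T i)) -
    v (cellMap T n w (vertex T j)))))]

lemma discreteEnergy_smul (n : ℕ) (c : ℝ) (u : Gasket T → ℝ) :
    discreteEnergy T n (c • u) = c ^ 2 * discreteEnergy T n u := by
  simp only [discreteEnergy, Finset.mul_sum, Pi.smul_apply, smul_eq_mul]
  refine Finset.sum_congr rfl fun w _ => Finset.sum_congr rfl fun i _ =>
    Finset.sum_congr rfl fun j _ => ?_
  ring

lemma FiniteEnergy.smul {u : Gasket T → ℝ} (hu : FiniteEnergy T u) (c : ℝ) :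
    FiniteEnergy T (c • u) :=
  finiteEnergy_of_tendsto_le (hu.tendsto.const_mul (c ^ 2)) fun n => (discreteEnergy_smul n c u).le

lemma FiniteEnergy.sub {u v : Gasket T → ℝ} (hu : FiniteEnergy T u) (hv : FiniteEnergy T v) :
    FiniteEnergy T (u - v) := by
  have := hu.add (hv.smul (-1))
  rwa [neg_one_smul, ← sub_eq_add_neg] at this

lemma energy_smul {u : Gasket T → ℝ} (hu : FiniteEnergy T u) (c : ℝ) :
    energy T (c • u) = c ^ 2 * energy T u := by
  refine tendsto_nhds_unique (hu.smul c).tendsto ?_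
  simp only [discreteEnergy_smul]
  exact hu.tendsto.const_mul _

lemma FiniteEnergy.comp_contraction {u : Gasket T → ℝ} (hu : FiniteEnergy T u) (i : Fin 3) :
    FiniteEnergy T (fun x => u (contraction T i x)) := by
  refine finiteEnergy_of_tendsto_le (hu.tendsto.comp (tendsto_add_atTop_nat 1)) fun n => ?_
  rw [Function.comp_apply, discreteEnergy_succ]
  have := Finset.single_le_sum (f := fun i => discreteEnergy T n (fun x => u (contraction T i x)))
    (fun i _ => discreteEnergy_nonneg T n _) (Finset.mem_univ i)
  have h0 := discreteEnergy_nonneg T n (fun x => u (contraction T i x))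
  linarith

lemma FiniteEnergy.comp_cellMap (n : ℕ) : ∀ {u : Gasket T → ℝ}, FiniteEnergy T u →
    ∀ w : Fin n → Fin 3, FiniteEnergy T (fun x => u (cellMap T n w x)) := by
  induction n with
  | zero => intro u hu w; exact hu
  | succ n ih => intro u hu w; exact ih (hu.comp_contraction (w 0)) _

lemma energy_self_similar {u : Gasket T → ℝ} (hu : FiniteEnergy T u) :
    energy T u = (5 / 3 : ℝ) * ∑ i, energy T (fun x => u (contraction T i x)) := by
  refine tendsto_nhds_unique (hu.tendsto.comp (tendsto_add_atTop_nat 1)) ?_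
  simp only [Function.comp_def, discreteEnergy_succ]
  exact (tendsto_finsetSum _ fun i _ => (hu.comp_contraction i).tendsto).const_mul _

/-- Polarized additivity of the energy. -/
lemma energy_add_identity {f g h : Gasket T → ℝ} (hf : FiniteEnergy T f) (hg : FiniteEnergy T g)
    (hh : FiniteEnergy T h) :
    energy T (f + g + h) + energy T (f - h) + energy T (g - h) =
      energy T (f + g - h) + energy T (f + h) + energy T (g + h) := by
  refine tendsto_nhds_unique
    ((((hf.add hg).add hh).tendsto.add (hf.sub hh).tendsto).add (hg.sub hh).tendsto)
    (Tendsto.congr (fun n => ?_)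
    ((((hf.add hg).sub hh).tendsto.add (hf.add hh).tendsto).add (hg.add hh).tendsto))
  simp only [discreteEnergy, Finset.mul_sum, ← Finset.sum_add_distrib, Pi.add_apply, Pi.sub_apply]
  refine Finset.sum_congr rfl fun w _ => Finset.sum_congr rfl fun i _ =>
    Finset.sum_congr rfl fun j _ => ?_
  ring

/-- Polarized homogeneity of the energy. -/
lemma energy_smul_identity {f g : Gasket T → ℝ} (hf : FiniteEnergy T f) (hg : FiniteEnergy T g)
    (t : ℝ) :
    energy T (t • f + g) + t * energy T (f - g) = energy T (t • f - g) + t * energy T (f + g) := by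
  refine tendsto_nhds_unique
    (((hf.smul t).add hg).tendsto.add ((hf.sub hg).tendsto.const_mul t))
    (Tendsto.congr (fun n => ?_)
    (((hf.smul t).sub hg).tendsto.add ((hf.add hg).tendsto.const_mul t)))
  simp only [discreteEnergy, Finset.mul_sum,
    ← Finset.sum_add_distrib, Pi.add_apply, Pi.sub_apply, Pi.smul_apply, smul_eq_mul]
  refine Finset.sum_congr rfl fun w _ => Finset.sum_congr rfl fun i _ =>
    Finset.sum_congr rfl fun j _ => ?_
  ring

/-- The real space `F` of continuous functions of finite energy. -/
def energyDomain (T : Affine.Triangle ℝ Plane) : Submodule ℝ C(Gasket T, ℝ) where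
  carrier := {u | FiniteEnergy T u}
  add_mem' hu hv := FiniteEnergy.add hu hv
  zero_mem' := finiteEnergy_const 0
  smul_mem' c _ hu := FiniteEnergy.smul hu c

/-- The bilinear energy form `E(u, v)`, by polarization. -/
def energyForm (u v : energyDomain T) : ℝ :=
  (energy T ⇑(u + v).1 - energy T ⇑(u - v).1) / 4

/-- `u` is harmonic: it minimizes the energy among all functions of finite energy with the same
values at the three boundary vertices. -/
def IsHarmonic (u : energyDomain T) : Prop :=
  ∀ v : energyDomain T, (∀ i, v.1 (vertex T i) = u.1 (vertex T i)) →
    energy T ⇑u.1 ≤ energy T ⇑v.1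

/-- `h = (h_1, h_2)` is a complete energy orthonormal system for the space of harmonic functions
modulo constants. -/
structure IsHarmonicONS (h : Fin 2 → energyDomain T) : Prop where
  harmonic : ∀ i, IsHarmonic (h i)
  orthonormal : ∀ i j, energyForm (h i) (h j) = if i = j then 1 else 0
  complete : ∀ u : energyDomain T, IsHarmonic u →
    ∃ (c : ℝ) (a : Fin 2 → ℝ), ∀ x, u.1 x = c + ∑ i, a i * (h i).1 x

/-! ### Energy measures -/

/-- The Riemann sums `∑_{|w| = n} φ(φ_w p_1) ν_u(K_w)`, where the cell `K_w = φ_w K` carries the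
energy `ν_u(K_w) = (5/3)^n E(u ∘ φ_w)`. -/
def riemannSum (T : Affine.Triangle ℝ Plane) (u f : Gasket T → ℝ) (n : ℕ) : ℝ :=
  ∑ w : Fin n → Fin 3, f (cellMap T n w (vertex T 0)) *
    ((5 / 3 : ℝ) ^ n * energy T (fun x => u (cellMap T n w x)))

lemma riemannSum_succ (u f : Gasket T → ℝ) (n : ℕ) :
    riemannSum T u f (n + 1) = (5 / 3 : ℝ) * ∑ i, riemannSum T (fun x => u (contraction T i x))
      (fun x => f (contraction T i x)) n := by
  simp only [riemannSum, sum_words, cellMap_cons, Finset.mul_sum]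
  refine Finset.sum_congr rfl fun i _ => Finset.sum_congr rfl fun w _ => ?_
  ring

lemma riemannSum_bound (n : ℕ) : ∀ {u : Gasket T → ℝ}, FiniteEnergy T u →
    ∀ {f : Gasket T → ℝ} {c ε : ℝ}, (∀ x, |f x - c| ≤ ε) →
    |riemannSum T u f n - c * energy T u| ≤ ε * energy T u := by
  induction n with
  | zero =>
    intro u hu f c ε hf
    simp only [riemannSum, cellMap, Finset.univ_unique, Finset.sum_singleton, pow_zero, one_mul]
    rw [← sub_mul, abs_mul, abs_of_nonneg (energy_nonneg u)]
    exact mul_le_mul_of_nonneg_right (hf _) (energy_nonneg u)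
  | succ n ih =>
    intro u hu f c ε hf
    rw [riemannSum_succ, energy_self_similar hu, mul_left_comm c, mul_left_comm ε, ← mul_sub,
      Finset.mul_sum, Finset.mul_sum, ← Finset.sum_sub_distrib, abs_mul,
      abs_of_pos (by norm_num : (0 : ℝ) < 5 / 3)]
    gcongr
    refine (Finset.abs_sum_le_sum_abs _ _).trans (Finset.sum_le_sum fun i _ => ?_)
    exact ih (hu.comp_contraction i) fun x => hf _

lemma riemannSum_osc (n m : ℕ) : ∀ {u : Gasket T → ℝ}, FiniteEnergy T u →
    ∀ {f : Gasket T → ℝ} {ε : ℝ},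
    (∀ (w : Fin n → Fin 3) (x y : Gasket T), |f (cellMap T n w x) - f (cellMap T n w y)| ≤ ε) →
    |riemannSum T u f (n + m) - riemannSum T u f n| ≤ ε * energy T u := by
  induction n with
  | zero =>
    intro u hu f ε hf
    have := riemannSum_bound m hu (f := f) (c := f (vertex T 0)) (ε := ε)
      (fun x => hf Fin.elim0 x _)
    rw [Nat.zero_add]
    simpa [riemannSum, cellMap] using this
  | succ n ih =>
    intro u hu f ε hf
    rw [Nat.add_right_comm, riemannSum_succ, riemannSum_succ, energy_self_similar hu,
      mul_left_comm ε, ← mul_sub, Finset.mul_sum, ← Finset.sum_sub_distrib, abs_mul,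
      abs_of_pos (by norm_num : (0 : ℝ) < 5 / 3)]
    gcongr
    refine (Finset.abs_sum_le_sum_abs _ _).trans (Finset.sum_le_sum fun i _ => ?_)
    refine ih (hu.comp_contraction i) fun w x y => ?_
    have := hf (Fin.cons i w) x y
    rwa [cellMap_cons, cellMap_cons] at this

lemma dist_cellMap (n : ℕ) (w : Fin n → Fin 3) (x y : Gasket T) :
    dist (cellMap T n w x) (cellMap T n w y) = (1 / 2 : ℝ) ^ n * dist x y := by
  induction n with
  | zero => simp [cellMap]
  | succ n ih =>
    have : ∀ (i : Fin 3) (x y : Gasket T),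
      dist (contraction T i x) (contraction T i y) = (1 / 2 : ℝ) * dist x y :=
      fun i x y => phi_dist T i x y
    rw [cellMap, cellMap, this, ih, pow_succ']
    ring

lemma riemannSum_cauchy {u : Gasket T → ℝ} (hu : FiniteEnergy T u) {f : Gasket T → ℝ}
    (hf : Continuous f) : CauchySeq (riemannSum T u f) := by
  rw [Metric.cauchySeq_iff']
  intro ε hε
  obtain ⟨η, hη, hη'⟩ : ∃ η > 0, η * energy T u < ε := by
    refine ⟨ε / (energy T u + 1), div_pos hε (by linarith [energy_nonneg u]), ?_⟩
    rw [div_mul_eq_mul_div, div_lt_iff₀ (by linarith [energy_nonneg u])]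
    nlinarith [energy_nonneg u]
  obtain ⟨δ, hδ, H⟩ := Metric.uniformContinuous_iff.1
    (CompactSpace.uniformContinuous_of_continuous hf) η hη
  obtain ⟨N, hN⟩ : ∃ N : ℕ, (1 / 2 : ℝ) ^ N * Metric.diam (Set.univ : Set (Gasket T)) < δ := by
    have : Tendsto (fun n : ℕ => (1 / 2 : ℝ) ^ n * Metric.diam (Set.univ : Set (Gasket T))) atTop
        (𝓝 (0 * _)) :=
      (tendsto_pow_atTop_nhds_zero_of_lt_one (by norm_num) (by norm_num)).mul_const _
    rw [zero_mul] at this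
    exact (this.eventually_lt_const hδ).exists
  refine ⟨N, fun n hn => ?_⟩
  obtain ⟨m, rfl⟩ := Nat.exists_eq_add_of_le hn
  refine (riemannSum_osc N m hu fun w x y => ?_).trans_lt hη'
  refine (H ?_).le
  rw [dist_cellMap]
  refine lt_of_le_of_lt ?_ hN
  gcongr
  exact Metric.dist_le_diam_of_mem isCompact_univ.isBounded (Set.mem_univ _) (Set.mem_univ _)

/-- `∫ f dν_u` as the limit of the Riemann sums. -/
def riemannLimit (T : Affine.Triangle ℝ Plane) (u f : Gasket T → ℝ) : ℝ :=
  limUnder atTop (riemannSum T u f)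

lemma tendsto_riemannSum {u : Gasket T → ℝ} (hu : FiniteEnergy T u) {f : Gasket T → ℝ}
    (hf : Continuous f) : Tendsto (riemannSum T u f) atTop (𝓝 (riemannLimit T u f)) :=
  (riemannSum_cauchy hu hf).tendsto_limUnder

/-- The positive linear functional `f ↦ ∫ f dν_u` on `C(K)`. -/
def energyFunctional (u : energyDomain T) : CompactlySupportedContinuousMap (Gasket T) ℝ →ₚ[ℝ] ℝ :=
  PositiveLinearMap.mk₀
    { toFun := fun f => riemannLimit T u.1 f
      map_add' := fun f g => by
        refine tendsto_nhds_unique (tendsto_riemannSum u.2 (f + g).continuous)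
          (((tendsto_riemannSum u.2 f.continuous).add
            (tendsto_riemannSum u.2 g.continuous)).congr fun n => ?_)
        simp [riemannSum, add_mul, Finset.sum_add_distrib]
      map_smul' := fun c f => by
        refine tendsto_nhds_unique (tendsto_riemannSum u.2 (c • f).continuous)
          (((tendsto_riemannSum u.2 f.continuous).const_mul c).congr fun n => ?_)
        simp [riemannSum, Finset.mul_sum, mul_assoc] }
    fun f hf => ge_of_tendsto' (tendsto_riemannSum u.2 f.continuous) fun n =>
      Finset.sum_nonneg fun w _ => mul_nonneg (hf _) (mul_nonneg (by positivity) (energy_nonneg _))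

/-- The energy measure `ν_u` of `u ∈ F`: the Borel measure on `K` with
`∫ f dν_u = lim_n ∑_{|w| = n} f(φ_w p_1) (5/3)^n E(u ∘ φ_w)` for all continuous `f`. -/
def energyMeasure (u : energyDomain T) : Measure (Gasket T) :=
  RealRMK.rieszMeasure (energyFunctional u)

instance (u : energyDomain T) : IsFiniteMeasure (energyMeasure u) := by
  unfold energyMeasure; infer_instance

lemma tendsto_integral_energyMeasure (u : energyDomain T) (f : C(Gasket T, ℝ)) :
    Tendsto (riemannSum T u.1 f) atTop (𝓝 (∫ x, f x ∂(energyMeasure u))) := by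
  have := RealRMK.integral_rieszMeasure (energyFunctional u)
    ⟨f, HasCompactSupport.of_compactSpace _⟩
  change ∫ x, f x ∂(energyMeasure u) = _ at this
  rw [this]
  exact tendsto_riemannSum u.2 f.continuous

lemma finite_measure_ext {μ ν : Measure (Gasket T)} [IsFiniteMeasure μ] [IsFiniteMeasure ν]
    (h : ∀ f : C(Gasket T, ℝ), ∫ x, f x ∂μ = ∫ x, f x ∂ν) : μ = ν :=
  ext_of_forall_integral_eq_of_IsFiniteMeasure fun f => h f.toContinuousMap

lemma integrable_of_continuous (μ : Measure (Gasket T)) [IsFiniteMeasure μ]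
    (f : C(Gasket T, ℝ)) : Integrable (fun x => f x) μ :=
  f.continuous.integrable_of_hasCompactSupport (HasCompactSupport.of_compactSpace _)

lemma energyMeasure_add_identity (f g h : energyDomain T) :
    energyMeasure (f + g + h) + energyMeasure (f - h) + energyMeasure (g - h) =
      energyMeasure (f + g - h) + energyMeasure (f + h) + energyMeasure (g + h) := by
  refine finite_measure_ext fun k => ?_
  simp only [integral_add_measure, integrable_of_continuous, Integrable.add_measure]
  refine tendsto_nhds_unique (((tendsto_integral_energyMeasure (f + g + h) k).add
    (tendsto_integral_energyMeasure (f - h) k)).add (tendsto_integral_energyMeasure (g - h) k))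
    (Tendsto.congr (fun n => ?_) (((tendsto_integral_energyMeasure (f + g - h) k).add
    (tendsto_integral_energyMeasure (f + h) k)).add (tendsto_integral_energyMeasure (g + h) k)))
  simp only [riemannSum, ← Finset.sum_add_distrib, ← mul_add]
  refine Finset.sum_congr rfl fun w _ => ?_
  congr 2
  exact (energy_add_identity (FiniteEnergy.comp_cellMap n f.2 w)
    (FiniteEnergy.comp_cellMap n g.2 w) (FiniteEnergy.comp_cellMap n h.2 w)).symm

lemma energyMeasure_smul_identity (f g : energyDomain T) (t : ℝ≥0) :
    energyMeasure ((t : ℝ) • f + g) + t • energyMeasure (f - g) =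
      energyMeasure ((t : ℝ) • f - g) + t • energyMeasure (f + g) := by
  refine finite_measure_ext fun k => ?_
  simp only [integral_add_measure, integrable_of_continuous, integral_smul_nnreal_measure,
    NNReal.smul_def, smul_eq_mul]
  refine tendsto_nhds_unique ((tendsto_integral_energyMeasure ((t : ℝ) • f + g) k).add
    ((tendsto_integral_energyMeasure (f - g) k).const_mul (t : ℝ)))
    (Tendsto.congr (fun n => ?_) ((tendsto_integral_energyMeasure ((t : ℝ) • f - g) k).add
    ((tendsto_integral_energyMeasure (f + g) k).const_mul (t : ℝ))))
  simp only [riemannSum, ← Finset.sum_add_distrib, Finset.mul_sum]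
  refine Finset.sum_congr rfl fun w _ => ?_
  have key := energy_smul_identity (FiniteEnergy.comp_cellMap n f.2 w)
    (FiniteEnergy.comp_cellMap n g.2 w) t
  change k _ * (_ * energy T ((t : ℝ) • (fun x => f.1 (cellMap T n w x)) -
      fun x => g.1 (cellMap T n w x))) + t * (k _ * (_ * energy T
      ((fun x => f.1 (cellMap T n w x)) + fun x => g.1 (cellMap T n w x)))) =
    k _ * (_ * energy T ((t : ℝ) • (fun x => f.1 (cellMap T n w x)) +
      fun x => g.1 (cellMap T n w x))) + t * (k _ * (_ * energy T
      ((fun x => f.1 (cellMap T n w x)) - fun x => g.1 (cellMap T n w x))))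
  linear_combination (-k (cellMap T n w (vertex T 0)) * (5 / 3 : ℝ) ^ n) * key

lemma energyMeasure_smul (f : energyDomain T) (t : ℝ) :
    energyMeasure (t • f) = (Real.toNNReal (t ^ 2)) • energyMeasure f := by
  refine finite_measure_ext fun k => ?_
  rw [integral_smul_nnreal_measure, NNReal.smul_def, Real.coe_toNNReal _ (sq_nonneg t), smul_eq_mul]
  refine tendsto_nhds_unique (tendsto_integral_energyMeasure (t • f) k)
    (Tendsto.congr (fun n => ?_) ((tendsto_integral_energyMeasure f k).const_mul (t ^ 2)))
  simp only [riemannSum, Finset.mul_sum]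
  refine Finset.sum_congr rfl fun w _ => ?_
  have := energy_smul (FiniteEnergy.comp_cellMap n f.2 w) t
  change _ = k _ * ((5 / 3 : ℝ) ^ n * energy T (t • fun x => f.1 (cellMap T n w x)))
  rw [this]
  ring

lemma energyMeasure_neg (f : energyDomain T) : energyMeasure (-f) = energyMeasure f := by
  rw [← neg_one_smul ℝ f, energyMeasure_smul, show ((-1 : ℝ) ^ 2) = 1 by norm_num,
    Real.toNNReal_one, one_smul]

lemma toReal_rnDeriv_add_identity {X : Type*} [MeasurableSpace X] {a b c a' b' c' ν : Measure X}
    [IsFiniteMeasure a] [IsFiniteMeasure b] [IsFiniteMeasure c] [IsFiniteMeasure a']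
    [IsFiniteMeasure b'] [IsFiniteMeasure c'] [IsFiniteMeasure ν] (key : a + b + c = a' + b' + c') :
    ∀ᵐ x ∂ν, (a.rnDeriv ν x).toReal + (b.rnDeriv ν x).toReal + (c.rnDeriv ν x).toReal =
      (a'.rnDeriv ν x).toReal + (b'.rnDeriv ν x).toReal + (c'.rnDeriv ν x).toReal := by
  have e1 := Measure.rnDeriv_add (a + b) c ν
  have e3 := Measure.rnDeriv_add (a' + b') c' ν
  rw [key] at e1
  filter_upwards [e1, Measure.rnDeriv_add a b ν, e3, Measure.rnDeriv_add a' b' ν,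
    Measure.rnDeriv_ne_top a ν, Measure.rnDeriv_ne_top b ν, Measure.rnDeriv_ne_top c ν,
    Measure.rnDeriv_ne_top a' ν, Measure.rnDeriv_ne_top b' ν, Measure.rnDeriv_ne_top c' ν]
    with x h1 h2 h3 h4 t1 t2 t3 t4 t5 t6
  rw [h1] at h3
  simp only [Pi.add_apply, h2, h4] at h3
  have := congrArg ENNReal.toReal h3
  rwa [ENNReal.toReal_add (ENNReal.add_ne_top.2 ⟨t1, t2⟩) t3, ENNReal.toReal_add t1 t2,
    ENNReal.toReal_add (ENNReal.add_ne_top.2 ⟨t4, t5⟩) t6, ENNReal.toReal_add t4 t5] at this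

lemma toReal_rnDeriv_smul {X : Type*} [MeasurableSpace X] (a ν : Measure X)
    [IsFiniteMeasure a] [IsFiniteMeasure ν] (t : ℝ≥0) :
    ∀ᵐ x ∂ν, ((t • a).rnDeriv ν x).toReal = t * (a.rnDeriv ν x).toReal := by
  filter_upwards [Measure.rnDeriv_smul_left a ν t] with x h
  rw [h, Pi.smul_apply, ENNReal.smul_def, smul_eq_mul, ENNReal.toReal_mul, ENNReal.coe_toReal]

lemma toReal_rnDeriv_add {X : Type*} [MeasurableSpace X] (a b ν : Measure X)
    [IsFiniteMeasure a] [IsFiniteMeasure b] [IsFiniteMeasure ν] :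
    ∀ᵐ x ∂ν, ((a + b).rnDeriv ν x).toReal = (a.rnDeriv ν x).toReal + (b.rnDeriv ν x).toReal := by
  filter_upwards [Measure.rnDeriv_add a b ν, Measure.rnDeriv_ne_top a ν,
    Measure.rnDeriv_ne_top b ν] with x h t1 t2
  rw [h, Pi.add_apply, ENNReal.toReal_add t1 t2]

/-- The Kusuoka measure `ν = ν_{h_1} + ν_{h_2}`. -/
def kusuoka (h : Fin 2 → energyDomain T) : Measure (Gasket T) :=
  energyMeasure (h 0) + energyMeasure (h 1)

instance (h : Fin 2 → energyDomain T) : IsFiniteMeasure (kusuoka h) := by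
  unfold kusuoka; infer_instance

variable (h : Fin 2 → energyDomain T)

/-- The density `Γ(f) = dν_f / dν` of the energy measure of a real function `f ∈ F`. -/
def density (f : energyDomain T) (x : Gasket T) : ℝ :=
  ((energyMeasure f).rnDeriv (kusuoka h) x).toReal

/-- The density `Γ(f, g)` of the mutual energy measure `ν_{f,g} = (ν_{f+g} - ν_{f-g}) / 4` of two
real functions `f, g ∈ F` with respect to the Kusuoka measure. -/
def gamma (f g : energyDomain T) (x : Gasket T) : ℝ :=
  (density h (f + g) x - density h (f - g) x) / 4

lemma density_integrable (f : energyDomain T) : Integrable (density h f) (kusuoka h) :=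
  Measure.integrable_toReal_rnDeriv

lemma gamma_integrable (f g : energyDomain T) : Integrable (gamma h f g) (kusuoka h) :=
  ((density_integrable h _).sub (density_integrable h _)).div_const 4

lemma gamma_symm (f g : energyDomain T) (x : Gasket T) : gamma h f g x = gamma h g f x := by
  unfold gamma density
  rw [add_comm g f, ← neg_sub f g, energyMeasure_neg]

lemma gamma_neg_left (f g : energyDomain T) (x : Gasket T) :
    gamma h (-f) g x = - gamma h f g x := by
  unfold gamma density
  rw [show -f + g = -(f - g) by abel, show -f - g = -(f + g) by abel, energyMeasure_neg,
    energyMeasure_neg]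
  ring

lemma gamma_add_left (f g k : energyDomain T) :
    ∀ᵐ x ∂(kusuoka h), gamma h (f + g) k x = gamma h f k x + gamma h g k x := by
  filter_upwards [toReal_rnDeriv_add_identity (ν := kusuoka h)
    (energyMeasure_add_identity f g k)] with x hx
  unfold gamma density
  linarith

lemma gamma_smul_left_nonneg (t : ℝ≥0) (f k : energyDomain T) :
    ∀ᵐ x ∂(kusuoka h), gamma h ((t : ℝ) • f) k x = t * gamma h f k x := by
  have e1 := toReal_rnDeriv_add (energyMeasure ((t : ℝ) • f + k)) (t • energyMeasure (f - k))
    (kusuoka h)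
  rw [energyMeasure_smul_identity f k t] at e1
  filter_upwards [e1, toReal_rnDeriv_smul (energyMeasure (f - k)) (kusuoka h) t,
    toReal_rnDeriv_add (energyMeasure ((t : ℝ) • f - k)) (t • energyMeasure (f + k)) (kusuoka h),
    toReal_rnDeriv_smul (energyMeasure (f + k)) (kusuoka h) t] with x h1 h2 h3 h4
  rw [h2, h3, h4] at h1
  unfold gamma density
  linarith

lemma gamma_smul_left (t : ℝ) (f k : energyDomain T) :
    ∀ᵐ x ∂(kusuoka h), gamma h (t • f) k x = t * gamma h f k x := by
  rcases le_total 0 t with ht | ht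
  · exact gamma_smul_left_nonneg h ⟨t, ht⟩ f k
  · filter_upwards [gamma_smul_left_nonneg h ⟨-t, neg_nonneg.2 ht⟩ f k] with x hx
    have h1 := gamma_neg_left h ((-t) • f) k x
    have h2 : gamma h ((-t) • f) k x = (-t) * gamma h f k x := hx
    have h3 : t • f = -((-t) • f) := by module
    rw [h3, h1, h2]
    ring

lemma gamma_self (f : energyDomain T) : ∀ᵐ x ∂(kusuoka h), 0 ≤ gamma h f f x := by
  have e1 : energyMeasure (f + f) = (4 : ℝ≥0) • energyMeasure f := by
    rw [← two_smul ℝ f, energyMeasure_smul]; norm_num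
  have e2 : energyMeasure (f - f) = (0 : ℝ≥0) • energyMeasure f := by
    rw [sub_self, ← zero_smul ℝ f, energyMeasure_smul]; norm_num
  have e3 := Measure.rnDeriv_smul_left (energyMeasure f) (kusuoka h) 0
  filter_upwards [e3] with x h3
  unfold gamma density
  rw [e2, h3]
  simp only [Pi.smul_apply, zero_smul, ENNReal.toReal_zero, sub_zero]
  positivity

/-! ### Complexification -/

/-- The real part of a continuous complex function. -/
def rePart (f : C(Gasket T, ℂ)) : C(Gasket T, ℝ) := ⟨fun x => (f x).re, by fun_prop⟩

/-- The imaginary part of a continuous complex function. -/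
def imPart (f : C(Gasket T, ℂ)) : C(Gasket T, ℝ) := ⟨fun x => (f x).im, by fun_prop⟩

lemma rePart_add (f g : C(Gasket T, ℂ)) : rePart (f + g) = rePart f + rePart g := by
  ext x; simp [rePart]

lemma imPart_add (f g : C(Gasket T, ℂ)) : imPart (f + g) = imPart f + imPart g := by
  ext x; simp [imPart]

lemma rePart_smul (c : ℂ) (f : C(Gasket T, ℂ)) :
    rePart (c • f) = c.re • rePart f + (-c.im) • imPart f := by
  ext x; simp [rePart, imPart]; ring

lemma imPart_smul (c : ℂ) (f : C(Gasket T, ℂ)) :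
    imPart (c • f) = c.re • imPart f + c.im • rePart f := by
  ext x; simp [rePart, imPart]

/-- The complexification `F_ℂ = F + i F`: continuous complex functions whose real and imaginary
parts have finite energy. -/
def energyDomainC (T : Affine.Triangle ℝ Plane) : Submodule ℂ C(Gasket T, ℂ) where
  carrier := {f | rePart f ∈ energyDomain T ∧ imPart f ∈ energyDomain T}
  add_mem' {f g} hf hg := by
    refine ⟨?_, ?_⟩
    · rw [rePart_add]; exact add_mem hf.1 hg.1
    · rw [imPart_add]; exact add_mem hf.2 hg.2
  zero_mem' := ⟨finiteEnergy_const 0, finiteEnergy_const 0⟩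
  smul_mem' c f hf := by
    refine ⟨?_, ?_⟩
    · rw [rePart_smul]
      exact add_mem (Submodule.smul_mem _ _ hf.1) (Submodule.smul_mem _ _ hf.2)
    · rw [imPart_smul]
      exact add_mem (Submodule.smul_mem _ _ hf.2) (Submodule.smul_mem _ _ hf.1)

/-- The constant function `1` in `F_ℂ`. -/
def oneC (T : Affine.Triangle ℝ Plane) : energyDomainC T :=
  ⟨1, finiteEnergy_const 1, finiteEnergy_const 0⟩

/-- Real part `F_ℂ → F`. -/
def reF (f : energyDomainC T) : energyDomain T := ⟨rePart f.1, f.2.1⟩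

/-- Imaginary part `F_ℂ → F`. -/
def imF (f : energyDomainC T) : energyDomain T := ⟨imPart f.1, f.2.2⟩

lemma reF_add (f g : energyDomainC T) : reF (f + g) = reF f + reF g :=
  Subtype.ext (rePart_add f.1 g.1)
lemma imF_add (f g : energyDomainC T) : imF (f + g) = imF f + imF g :=
  Subtype.ext (imPart_add f.1 g.1)
lemma reF_smul (c : ℂ) (f : energyDomainC T) : reF (c • f) = c.re • reF f + (-c.im) • imF f :=
  Subtype.ext (rePart_smul c f.1)
lemma imF_smul (c : ℂ) (f : energyDomainC T) : imF (c • f) = c.re • imF f + c.im • reF f :=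
  Subtype.ext (imPart_smul c f.1)

/-- The complexified density `Γ(f, g) = Γ(f_1, g_1) - i Γ(f_1, g_2) + i Γ(f_2, g_1) + Γ(f_2, g_2)`
for `f = f_1 + i f_2`, `g = g_1 + i g_2`; linear in `f` and conjugate linear in `g`. -/
def gammaC (f g : energyDomainC T) (x : Gasket T) : ℂ :=
  (gamma h (reF f) (reF g) x : ℂ) - Complex.I * gamma h (reF f) (imF g) x
    + Complex.I * gamma h (imF f) (reF g) x + gamma h (imF f) (imF g) x

lemma gammaC_symm (f g : energyDomainC T) (x : Gasket T) :
    conj (gammaC h f g x) = gammaC h g f x := by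
  unfold gammaC
  rw [gamma_symm h (reF g), gamma_symm h (reF g), gamma_symm h (imF g), gamma_symm h (imF g)]
  simp only [map_add, map_sub, map_mul, Complex.conj_ofReal, Complex.conj_I]
  ring

lemma gammaC_integrable (f g : energyDomainC T) : Integrable (gammaC h f g) (kusuoka h) :=
  (((gamma_integrable h _ _).ofReal.sub ((gamma_integrable h _ _).ofReal.const_mul _)).add
    ((gamma_integrable h _ _).ofReal.const_mul _)).add (gamma_integrable h _ _).ofReal

lemma gammaC_add_left (f g k : energyDomainC T) :
    ∀ᵐ x ∂(kusuoka h), gammaC h (f + g) k x = gammaC h f k x + gammaC h g k x := by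
  filter_upwards [gamma_add_left h (reF f) (reF g) (reF k), gamma_add_left h (reF f) (reF g) (imF k),
    gamma_add_left h (imF f) (imF g) (reF k), gamma_add_left h (imF f) (imF g) (imF k)]
    with x h1 h2 h3 h4
  simp only [gammaC, reF_add, imF_add, h1, h2, h3, h4, Complex.ofReal_add]
  ring

lemma gammaC_smul_left (c : ℂ) (f k : energyDomainC T) :
    ∀ᵐ x ∂(kusuoka h), gammaC h (c • f) k x = c * gammaC h f k x := by
  have key : ∀ (a b : ℝ) (u v w : energyDomain T), ∀ᵐ x ∂(kusuoka h),
      gamma h (a • u + b • v) w x = a * gamma h u w x + b * gamma h v w x := by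
    intro a b u v w
    filter_upwards [gamma_add_left h (a • u) (b • v) w, gamma_smul_left h a u w,
      gamma_smul_left h b v w] with x h1 h2 h3
    rw [h1, h2, h3]
  filter_upwards [key c.re (-c.im) (reF f) (imF f) (reF k), key c.re (-c.im) (reF f) (imF f) (imF k),
    key c.re c.im (imF f) (reF f) (reF k), key c.re c.im (imF f) (reF f) (imF k)] with x h1 h2 h3 h4
  simp only [gammaC, reF_smul, imF_smul, h1, h2, h3, h4]
  conv_rhs => rw [← Complex.re_add_im c]
  push_cast
  linear_combination ((c.im : ℂ) * gamma h (reF f) (imF k) x -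
    (c.im : ℂ) * gamma h (imF f) (reF k) x) * Complex.I_sq

lemma gammaC_self (f : energyDomainC T) : ∀ᵐ x ∂(kusuoka h), 0 ≤ (gammaC h f f x).re := by
  filter_upwards [gamma_self h (reF f), gamma_self h (imF f)] with x h1 h2
  simp [gammaC]
  linarith

/-! ### The space of one-forms -/

/-- The elements of `F_ℂ` as functions. -/
def evalC (f : energyDomainC T) (x : Gasket T) : ℂ := f.1 x

lemma evalC_add (f g : energyDomainC T) (x : Gasket T) :
    evalC (f + g) x = evalC f x + evalC g x := rfl

lemma evalC_smul (c : ℂ) (f : energyDomainC T) (x : Gasket T) :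
    evalC (c • f) x = c * evalC f x := rfl

lemma continuous_evalC (f : energyDomainC T) : Continuous (evalC f) := f.1.continuous

lemma integrand_integrable (a b c d : energyDomainC T) :
    Integrable (fun x => evalC b x * conj (evalC d x) * gammaC h a c x) (kusuoka h) := by
  have hc : Continuous fun x => evalC b x * conj (evalC d x) :=
    (continuous_evalC b).mul (Complex.continuous_conj.comp (continuous_evalC d))
  obtain ⟨C, hC⟩ := (isCompact_range hc).isBounded.exists_norm_le
  exact (gammaC_integrable h a c).bdd_mul hc.aestronglyMeasurable
    (Eventually.of_forall fun x => hC _ ⟨x, rfl⟩)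

/-- The form `⟨a ⊗ b, c ⊗ d⟩ = ∫_K b conj(d) Γ(a, c) dν` on simple tensors. -/
def pairing (a b c d : energyDomainC T) : ℂ :=
  ∫ x, evalC b x * conj (evalC d x) * gammaC h a c x ∂(kusuoka h)

lemma pairing_symm (a b c d : energyDomainC T) :
    conj (pairing h a b c d) = pairing h c d a b := by
  unfold pairing
  rw [← integral_conj]
  refine integral_congr_ae (Eventually.of_forall fun x => ?_)
  simp only [map_mul, gammaC_symm, Complex.conj_conj]
  ring

lemma pairing_add_left (a a' b c d : energyDomainC T) :
    pairing h (a + a') b c d = pairing h a b c d + pairing h a' b c d := by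
  unfold pairing
  rw [← integral_add (integrand_integrable h _ _ _ _) (integrand_integrable h _ _ _ _)]
  refine integral_congr_ae ?_
  filter_upwards [gammaC_add_left h a a' c] with x hx
  rw [hx]; ring

lemma pairing_smul_left (r : ℂ) (a b c d : energyDomainC T) :
    pairing h (r • a) b c d = r * pairing h a b c d := by
  unfold pairing
  rw [← integral_const_mul]
  refine integral_congr_ae ?_
  filter_upwards [gammaC_smul_left h r a c] with x hx
  rw [hx]; ring

lemma pairing_add_right (a b b' c d : energyDomainC T) :
    pairing h a (b + b') c d = pairing h a b c d + pairing h a b' c d := by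
  unfold pairing
  rw [← integral_add (integrand_integrable h _ _ _ _) (integrand_integrable h _ _ _ _)]
  refine integral_congr_ae (Eventually.of_forall fun x => ?_)
  simp only [evalC_add]; ring

lemma pairing_smul_right (r : ℂ) (a b c d : energyDomainC T) :
    pairing h a (r • b) c d = r * pairing h a b c d := by
  unfold pairing
  rw [← integral_const_mul]
  refine integral_congr_ae (Eventually.of_forall fun x => ?_)
  simp only [evalC_smul]; ring

lemma pairing_add_left' (a b c c' d : energyDomainC T) :
    pairing h a b (c + c') d = pairing h a b c d + pairing h a b c' d := by
  rw [← pairing_symm, pairing_add_left, map_add, pairing_symm, pairing_symm]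

lemma pairing_smul_left' (r : ℂ) (a b c d : energyDomainC T) :
    pairing h a b (r • c) d = conj r * pairing h a b c d := by
  rw [← pairing_symm, pairing_smul_left, map_mul, pairing_symm]

lemma pairing_add_right' (a b c d d' : energyDomainC T) :
    pairing h a b c (d + d') = pairing h a b c d + pairing h a b c d' := by
  rw [← pairing_symm, pairing_add_right, map_add, pairing_symm, pairing_symm]

lemma pairing_smul_right' (r : ℂ) (a b c d : energyDomainC T) :
    pairing h a b c (r • d) = conj r * pairing h a b c d := by
  rw [← pairing_symm, pairing_smul_right, map_mul, pairing_symm]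

/-- The functional `t ↦ ⟨t, c ⊗ d⟩` on `F_ℂ ⊗ F_ℂ`. -/
def formAux (c d : energyDomainC T) : energyDomainC T ⊗[ℂ] energyDomainC T →ₗ[ℂ] ℂ :=
  TensorProduct.lift (LinearMap.mk₂ ℂ (fun a b => pairing h a b c d)
    (fun a a' b => pairing_add_left h a a' b c d) (fun r a b => pairing_smul_left h r a b c d)
    (fun a b b' => pairing_add_right h a b b' c d) (fun r a b => pairing_smul_right h r a b c d))

/-- The sesquilinear form on `F_ℂ ⊗ F_ℂ` determined by
`⟨a ⊗ b, c ⊗ d⟩ = ∫_K b conj(d) Γ(a, c) dν`, with the conjugate linear variable `c ⊗ d` as the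
first argument. -/
def form : energyDomainC T ⊗[ℂ] energyDomainC T →ₗ⋆[ℂ]
    energyDomainC T ⊗[ℂ] energyDomainC T →ₗ[ℂ] ℂ :=
  TensorProduct.lift (LinearMap.mk₂'ₛₗ (starRingEnd ℂ) (starRingEnd ℂ) (fun c d => formAux h c d)
    (fun c c' d => TensorProduct.ext' fun a b => pairing_add_left' h a b c c' d)
    (fun r c d => TensorProduct.ext' fun a b => pairing_smul_left' h r a b c d)
    (fun c d d' => TensorProduct.ext' fun a b => pairing_add_right' h a b c d d')
    (fun r c d => TensorProduct.ext' fun a b => pairing_smul_right' h r a b c d))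

lemma form_tmul (a b c d : energyDomainC T) :
    form h (c ⊗ₜ d) (a ⊗ₜ b) = pairing h a b c d := rfl

lemma form_symm (s t : energyDomainC T ⊗[ℂ] energyDomainC T) :
    conj (form h t s) = form h s t := by
  induction s with
  | zero => simp
  | add s s' h1 h2 => simp only [map_add, LinearMap.add_apply, h1, h2]
  | tmul a b =>
    induction t with
    | zero => simp
    | add t t' h1 h2 => simp only [map_add, LinearMap.add_apply, h1, h2]
    | tmul c d => rw [form_tmul, form_tmul, pairing_symm]

lemma gammaC_sum_left {n : ℕ} (ξ : Fin n → ℂ) (a : Fin n → energyDomainC T) (k : energyDomainC T) :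
    ∀ᵐ x ∂(kusuoka h), gammaC h (∑ i, ξ i • a i) k x = ∑ i, ξ i * gammaC h (a i) k x := by
  classical
  suffices H : ∀ s : Finset (Fin n), ∀ᵐ x ∂(kusuoka h),
      gammaC h (∑ i ∈ s, ξ i • a i) k x = ∑ i ∈ s, ξ i * gammaC h (a i) k x from H _
  intro s
  induction s using Finset.induction_on with
  | empty =>
    filter_upwards [gammaC_smul_left h 0 0 k] with x hx
    simpa using hx
  | insert j s hj ih =>
    filter_upwards [ih, gammaC_add_left h (ξ j • a j) (∑ i ∈ s, ξ i • a i) k,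
      gammaC_smul_left h (ξ j) (a j) k] with x h1 h2 h3
    rw [Finset.sum_insert hj, Finset.sum_insert hj, h2, h3, h1]

/-- The matrix `Γ(a_i, a_j)` is positive semidefinite almost everywhere. -/
lemma gammaC_psd {n : ℕ} (a : Fin n → energyDomainC T) :
    ∀ᵐ x ∂(kusuoka h), ∀ ξ : Fin n → ℂ,
      0 ≤ (∑ j, ∑ i, ξ i * conj (ξ j) * gammaC h (a i) (a j) x).re := by
  have key : ∀ ξ : Fin n → ℂ, ∀ᵐ x ∂(kusuoka h),
      0 ≤ (∑ j, ∑ i, ξ i * conj (ξ j) * gammaC h (a i) (a j) x).re := by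
    intro ξ
    have h1 : ∀ᵐ x ∂(kusuoka h), ∀ j, gammaC h (∑ i, ξ i • a i) (a j) x =
        ∑ i, ξ i * gammaC h (a i) (a j) x :=
      ae_all_iff.2 fun j => gammaC_sum_left h ξ a (a j)
    filter_upwards [h1, gammaC_sum_left h ξ a (∑ i, ξ i • a i), gammaC_self h (∑ i, ξ i • a i)]
      with x h1 h2 h3
    rw [h2] at h3
    refine h3.trans_eq (congrArg Complex.re ?_)
    have h4 : ∀ i, gammaC h (a i) (∑ j, ξ j • a j) x =
        ∑ j, conj (ξ j) * gammaC h (a i) (a j) x := by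
      intro i
      rw [← gammaC_symm, h1 i, map_sum]
      exact Finset.sum_congr rfl fun j _ => by rw [map_mul, gammaC_symm]
    rw [Finset.sum_comm]
    refine Finset.sum_congr rfl fun i _ => ?_
    rw [h4, Finset.mul_sum]
    exact Finset.sum_congr rfl fun j _ => by ring
  have h2 : ∀ᵐ x ∂(kusuoka h), ∀ k : ℕ,
      0 ≤ (∑ j, ∑ i, TopologicalSpace.denseSeq (Fin n → ℂ) k i *
        conj (TopologicalSpace.denseSeq (Fin n → ℂ) k j) * gammaC h (a i) (a j) x).re :=
    ae_all_iff.2 fun k => key _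
  filter_upwards [h2] with x hx
  have hclosed : IsClosed {ξ : Fin n → ℂ |
      0 ≤ (∑ j, ∑ i, ξ i * conj (ξ j) * gammaC h (a i) (a j) x).re} :=
    isClosed_le continuous_const (by fun_prop)
  intro ξ
  exact hclosed.closure_subset_iff.2 (Set.range_subset_iff.2 hx)
    (TopologicalSpace.denseRange_denseSeq (Fin n → ℂ) ξ)

lemma form_nonneg (t : energyDomainC T ⊗[ℂ] energyDomainC T) : 0 ≤ (form h t t).re := by
  obtain ⟨n, a, b, rfl⟩ := TensorProduct.exists_sum_tmul_eq t
  have h1 : form h (∑ j, a j ⊗ₜ b j) (∑ i, a i ⊗ₜ b i) =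
      ∫ x, ∑ j, ∑ i, evalC (b i) x * conj (evalC (b j) x) * gammaC h (a i) (a j) x
        ∂(kusuoka h) := by
    rw [integral_finsetSum _ fun j _ => integrable_finsetSum _ fun i _ =>
      integrand_integrable h _ _ _ _]
    simp only [map_sum, LinearMap.sum_apply, form_tmul]
    rw [Finset.sum_comm]
    refine Finset.sum_congr rfl fun j _ => ?_
    rw [integral_finsetSum _ fun i _ => integrand_integrable h _ _ _ _]
    rfl
  have h2 : Integrable (fun x => ∑ j, ∑ i, evalC (b i) x * conj (evalC (b j) x) *
      gammaC h (a i) (a j) x) (kusuoka h) :=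
    integrable_finsetSum _ fun j _ => integrable_finsetSum _ fun i _ =>
      integrand_integrable h _ _ _ _
  rw [h1]
  have h3 := integral_re h2
  change _ = Complex.re _ at h3
  rw [← h3]
  refine integral_nonneg_of_ae ?_
  filter_upwards [gammaC_psd h a] with x hx
  exact hx fun i => evalC (b i) x

/-- The positive semidefinite inner product of `F_ℂ ⊗ F_ℂ`. -/
@[reducible]
def formCore : PreInnerProductSpace.Core ℂ (energyDomainC T ⊗[ℂ] energyDomainC T) where
  inner s t := form h s t
  conj_inner_symm s t := form_symm h s t
  re_inner_nonneg t := form_nonneg h t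
  add_left s s' t := congrArg (fun F => F t) ((form h).map_add s s')
  smul_left s t r := congrArg (fun F => F t) ((form h).map_smulₛₗ r s)

/-- The tensor product `F_ℂ ⊗ F_ℂ` with the positive semidefinite inner product
`⟨a ⊗ b, c ⊗ d⟩ = ∫_K b conj(d) Γ(a, c) dν`. -/
def PreForms (_h : Fin 2 → energyDomain T) : Type := energyDomainC T ⊗[ℂ] energyDomainC T

instance : SeminormedAddCommGroup (PreForms h) :=
  @InnerProductSpace.Core.toSeminormedAddCommGroup ℂ (energyDomainC T ⊗[ℂ] energyDomainC T) _ _ _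
    (formCore h)

instance : InnerProductSpace ℂ (PreForms h) :=
  @InnerProductSpace.ofCore ℂ (energyDomainC T ⊗[ℂ] energyDomainC T) _ _ _ (formCore h)

/-- The tensor `a ⊗ b` as an element of `PreForms h`. -/
def preTensor (a b : energyDomainC T) : PreForms h := a ⊗ₜ[ℂ] b

lemma preTensor_add_left (a a' b : energyDomainC T) :
    preTensor h (a + a') b = preTensor h a b + preTensor h a' b := TensorProduct.add_tmul a a' b

lemma preTensor_smul_left (r : ℂ) (a b : energyDomainC T) :
    preTensor h (r • a) b = r • preTensor h a b := (TensorProduct.smul_tmul' r a b).symm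

lemma inner_preTensor (a b c d : energyDomainC T) :
    inner ℂ (preTensor h c d) (preTensor h a b) = pairing h a b c d := rfl

/-- The Hilbert space `H_ℂ` of one-forms: the Hausdorff completion of `F_ℂ ⊗ F_ℂ`, that is, the
completion of the quotient of `F_ℂ ⊗ F_ℂ` by the tensors of norm zero. -/
abbrev OneForms : Type := UniformSpace.Completion (PreForms h)

/-- The class of `a ⊗ b` in `H_ℂ`. -/
def tensor (a b : energyDomainC T) : OneForms h := (preTensor h a b : PreForms h)

lemma inner_tensor (a b c d : energyDomainC T) :
    inner ℂ (tensor h c d) (tensor h a b) =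
      ∫ x, evalC b x * conj (evalC d x) * gammaC h a c x ∂(kusuoka h) :=
  (UniformSpace.Completion.inner_coe _ _).trans (inner_preTensor h a b c d)

/-! ### Derivation, divergence and the Dirac operator -/

/-- The Hilbert space `L²_ℂ(K, ν)`. -/
abbrev L2C : Type := Lp ℂ 2 (kusuoka h)

/-- The canonical map `F_ℂ → L²_ℂ(K, ν)`. -/
def toL2 : energyDomainC T →ₗ[ℂ] L2C h :=
  (ContinuousMap.toLp 2 (kusuoka h) ℂ).toLinearMap ∘ₗ (energyDomainC T).subtype

/-- The derivation `∂ f = f ⊗ 1` as a linear map `F_ℂ → H_ℂ`. -/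
def del : energyDomainC T →ₗ[ℂ] OneForms h where
  toFun f := tensor h f (oneC T)
  map_add' f g := by
    rw [tensor, preTensor_add_left, UniformSpace.Completion.coe_add]
    rfl
  map_smul' c f := by
    rw [tensor, preTensor_smul_left, UniformSpace.Completion.coe_smul]
    rfl

/-- The derivation `∂` as an unbounded operator from `L²_ℂ(K, ν)` to `H_ℂ` with domain `F_ℂ`: the
operator whose graph is the set of pairs `(f, f ⊗ 1)`, `f ∈ F_ℂ`. -/
def derivation : L2C h →ₗ.[ℂ] OneForms h :=
  (LinearMap.range ((toL2 h).prod (del h))).toLinearPMap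

/-- The divergence `∂^*` as an unbounded operator from `H_ℂ` to `L²_ℂ(K, ν)`: `-∂^*` is the Hilbert
space adjoint of `∂`, so that `⟨∂^* v, u⟩ = -⟨v, ∂ u⟩` for `u ∈ F_ℂ`. -/
def divergence : OneForms h →ₗ.[ℂ] L2C h := -(derivation h).adjoint

/-- The Hilbert space `L²_ℂ(K, ν) ⊕ H_ℂ`. -/
abbrev DiracSpace : Type := WithLp 2 (L2C h × OneForms h)

/-- The Dirac operator `D (f, ω) = (-i ∂^* ω, -i ∂ f)` with domain `F_ℂ ⊕ dom ∂^*`. -/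
def dirac : DiracSpace h →ₗ.[ℂ] DiracSpace h where
  domain := ((derivation h).domain.prod (divergence h).domain).comap
    (WithLp.linearEquiv 2 ℂ (L2C h × OneForms h)).toLinearMap
  toFun :=
    { toFun := fun z => WithLp.toLp 2
        (-Complex.I • divergence h ⟨z.1.snd, z.2.2⟩, -Complex.I • derivation h ⟨z.1.fst, z.2.1⟩)
      map_add' := fun y z => by
        have h1 := (divergence h).map_add ⟨y.1.snd, y.2.2⟩ ⟨z.1.snd, z.2.2⟩
        have h2 := (derivation h).map_add ⟨y.1.fst, y.2.1⟩ ⟨z.1.fst, z.2.1⟩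
        refine (congrArg₂ (fun a b => WithLp.toLp 2 (-Complex.I • a, -Complex.I • b)) h1 h2).trans ?_
        simp only [smul_add]
        rfl
      map_smul' := fun c z => by
        have h1 := (divergence h).map_smul c ⟨z.1.snd, z.2.2⟩
        have h2 := (derivation h).map_smul c ⟨z.1.fst, z.2.1⟩
        refine (congrArg₂ (fun a b => WithLp.toLp 2 (-Complex.I • a, -Complex.I • b)) h1 h2).trans ?_
        rw [smul_comm _ c, smul_comm _ c]
        rfl }
end SierpinskiGasket

end

noncomputable section

namespace SierpinskiGasket

open MeasureTheory Filter Topology TopologicalSpace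
open scoped ENNReal NNReal TensorProduct ComplexConjugate

variable {T : Affine.Triangle ℝ Plane}

/-! ### Barycentric coordinates and gluing -/

/-! Write `A` for the derivation. Since the divergence is `-A^*`, the Dirac operator is the block
operator with off-diagonal entries `i A^*` and `-i A`. Such an operator is self-adjoint as soon as
`A` is closed and densely defined: `A^*` is then densely defined and `A^** = A`, and testing an
element of `dom D^*` against vectors supported in one summand puts its components in `dom A^**` and
`dom A^*` (`isSelfAdjoint_dirac`). What remains is analysis on the gasket: injectivity of `F_ℂ →
L²`, density of its image, and closedness of the derivation.

The tools are harmonic functions. Extending boundary values by the rule `(2 a_i + 2 a_j + a_k) / 5`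
at midpoints leaves the discrete energy unchanged, and subtracting a harmonic function does not
alter the increments of discrete energy (`discreteEnergy_sub_harmonicExt`). Gluing harmonic
functions on cells of level `n` therefore approximates continuous functions uniformly and functions
of `F` in energy (`exists_piecewise_harmonic`).

A Kusuoka-null set is null for all harmonic energy measures. Self-similarity passes this to
piecewise harmonic functions and approximation to all of `F`, so every energy measure is absolutely
continuous with respect to `ν`. Hence no mass is lost in the densities and `‖∂f‖² = E(Re f) + E(Im
f)` (`norm_del_sq`). Self-similarity also pulls null sets back to cells, which shows that `ν` has
full support and gives injectivity.

For closedness, a chaining argument gives `|u(x) - u(p)| ≤ 5 √E(u)` for a fixed vertex `p`, so the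
graph norm controls the supremum norm. A graph-Cauchy sequence then converges uniformly, and lower
semicontinuity of the energy identifies its limit in the graph (`isClosed_derivation`). -/

/-- The vertices of `T` as an affine basis of the plane. -/
def vertexBasis (T : Affine.Triangle ℝ Plane) : AffineBasis (Fin 3) ℝ Plane :=
  ⟨T.points, T.independent,
    T.independent.affineSpan_eq_top_iff_card_eq_finrank_add_one.2 (by simp)⟩

/-- The barycentric coordinates with respect to `T`. -/
def bary (T : Affine.Triangle ℝ Plane) (k : Fin 3) (x : Plane) : ℝ := (vertexBasis T).coord k x

lemma continuous_bary (k : Fin 3) : Continuous (bary T k) :=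
  ((vertexBasis T).coord k).continuous_of_finiteDimensional

lemma bary_points (k i : Fin 3) : bary T k (T.points i) = if k = i then 1 else 0 :=
  (vertexBasis T).coord_apply k i

lemma sum_bary (x : Plane) : ∑ k, bary T k x = 1 := (vertexBasis T).sum_coord_apply_eq_one x

lemma bary_phi (k i : Fin 3) (x : Plane) :
    bary T k (phi T i x) = (1 / 2) * bary T k x + (1 / 2) * if k = i then 1 else 0 := by
  have h1 : phi T i x = AffineMap.lineMap (T.points i) x (1 / 2 : ℝ) := by
    rw [AffineMap.lineMap_apply_module, phi, add_comm]; norm_num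
  rw [h1, bary, AffineMap.apply_lineMap, AffineMap.lineMap_apply_module]
  have := bary_points (T := T) k i
  rw [bary] at this
  rw [this, bary, smul_eq_mul, smul_eq_mul]; ring

lemma exists_contraction_eq (x : Gasket T) : ∃ i y, contraction T i y = x := by
  have hx : (x : Plane) ∈ (gasketSet T : Set Plane) := x.2
  rw [gasketSet_eq] at hx
  obtain ⟨i, y, hy, h⟩ := Set.mem_iUnion.1 hx
  exact ⟨i, ⟨y, hy⟩, Subtype.ext h⟩

/-- Minimum principle: a minimum point lies in some cell, `y = φ_i z`, so the minimum is at least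
half of the value at `z`, hence at least half of itself. -/
lemma bary_nonneg (k : Fin 3) (x : Gasket T) : 0 ≤ bary T k x := by
  obtain ⟨y, -, hy⟩ := isCompact_univ.exists_isMinOn (Set.univ_nonempty (α := Gasket T))
    ((continuous_bary (T := T) k).comp continuous_subtype_val).continuousOn
  have hmin : ∀ z : Gasket T, bary T k y ≤ bary T k z := fun z => hy (Set.mem_univ z)
  obtain ⟨i, z, hz⟩ := exists_contraction_eq y
  have h1 : bary T k y = (1 / 2) * bary T k z + (1 / 2) * if k = i then 1 else 0 := by
    rw [← hz]; exact bary_phi k i z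
  have h2 := hmin z
  have h3 : (0 : ℝ) ≤ if k = i then 1 else 0 := by split_ifs <;> norm_num
  linarith [hmin x]

lemma eq_vertex_of_one_le_bary {i : Fin 3} {x : Gasket T} (hx : 1 ≤ bary T i x) :
    x = vertex T i := by
  have hs := sum_bary (T := T) x
  have h0 : ∀ k, bary T k x = if k = i then 1 else 0 := by
    intro k
    have := bary_nonneg (T := T) 0 x
    have := bary_nonneg (T := T) 1 x
    have := bary_nonneg (T := T) 2 x
    rw [Fin.sum_univ_three] at hs
    fin_cases i <;> fin_cases k <;> simp at hx ⊢ <;> linarith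
  refine Subtype.ext ((vertexBasis T).ext_elem fun k => ?_)
  exact (h0 k).trans (bary_points k i).symm

lemma contraction_injective (i : Fin 3) : Function.Injective (contraction T i) := by
  intro x y h
  have h1 : phi T i x = phi T i y := congrArg Subtype.val h
  refine Subtype.ext (dist_eq_zero.1 ?_)
  have := phi_dist T i x y
  rw [h1, dist_self] at this
  linarith

/-- Distinct cells touch only at one midpoint: comparing `i`-th coordinates gives `b_i(y) = b_i(x) +
1 ≥ 1`, which forces `y = p_i`, and symmetrically for `j`. -/
lemma eq_vertex_of_contraction_eq {i j : Fin 3} (hij : i ≠ j) {x y : Gasket T}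
    (h : contraction T i x = contraction T j y) : x = vertex T j ∧ y = vertex T i := by
  have h1 : phi T i x = phi T j y := congrArg Subtype.val h
  have h2 := congrArg (bary T i) h1
  have h3 := congrArg (bary T j) h1
  simp only [bary_phi, if_true, hij, hij.symm, if_false] at h2 h3
  have := bary_nonneg i x
  have := bary_nonneg j y
  exact ⟨eq_vertex_of_one_le_bary (by linarith), eq_vertex_of_one_le_bary (by linarith)⟩

lemma continuous_contraction (i : Fin 3) : Continuous (contraction T i) :=
  ((phi_lipschitz T i).continuous.comp continuous_subtype_val).subtype_mk _

/-- Continuous functions on the three cells `K_i` which agree at the common points of the cells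
glue to a continuous function on `K`. -/
lemma exists_glue {E : Type*} [TopologicalSpace E] (g : Fin 3 → C(Gasket T, E))
    (hg : ∀ i j, g i (vertex T j) = g j (vertex T i)) :
    ∃ G : C(Gasket T, E), ∀ i x, G (contraction T i x) = g i x := by
  -- `K` is a quotient of three disjoint copies of itself, because `q` is a continuous surjection
  -- from a compact space to a Hausdorff space; the matching condition says that `F` descends.
  let q : C(Fin 3 × Gasket T, Gasket T) :=
    ⟨fun p => contraction T p.1 p.2, continuous_prod_of_discrete_left.2 continuous_contraction⟩
  let F : C(Fin 3 × Gasket T, E) :=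
    ⟨fun p => g p.1 p.2, continuous_prod_of_discrete_left.2 fun i => (g i).continuous⟩
  have hsurj : Function.Surjective q := fun x => by
    obtain ⟨i, y, h⟩ := exists_contraction_eq x
    exact ⟨(i, y), h⟩
  have hq : IsQuotientMap q := IsQuotientMap.of_surjective_continuous hsurj q.continuous
  have hF : ∀ a b, q a = q b → F a = F b := by
    rintro ⟨i, x⟩ ⟨j, y⟩ (h : contraction T i x = contraction T j y)
    change g i x = g j y
    by_cases hij : i = j
    · subst hij
      rw [contraction_injective i h]
    · obtain ⟨rfl, rfl⟩ := eq_vertex_of_contraction_eq hij h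
      exact hg i j
  refine ⟨hq.lift F hF, fun i x => ?_⟩
  exact DFunLike.congr_fun (hq.lift_comp F hF) (i, x)

/-! ### The harmonic functions -/

/-- The three harmonic functions with boundary values `δ`, as a map into `ℝ³`, are the fixed point
of a contraction. -/
lemma exists_harmonic_basis (T : Affine.Triangle ℝ Plane) : ∃ H : C(Gasket T, Fin 3 → ℝ),
    (∀ k x, 0 ≤ H x k) ∧ (∀ x, ∑ k, H x k = 1) ∧
    (∀ k j, H (vertex T j) k = if k = j then 1 else 0) ∧
    ∀ i x k, H (contraction T i x) k =
      if k = i then (2 + 3 * H x i) / 5 else (1 + H x k - H x i) / 5 := by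
  -- The fixed point is sought among partitions of unity with the right boundary values; this set is
  -- closed, and the barycentric coordinates show that it is nonempty.
  let S : Set C(Gasket T, Fin 3 → ℝ) := {H | (∀ k x, 0 ≤ H x k) ∧ (∀ x, ∑ k, H x k = 1) ∧
    (∀ k j, H (vertex T j) k = if k = j then 1 else 0)}
  have hc : ∀ (x : Gasket T) (k : Fin 3), Continuous fun H : C(Gasket T, Fin 3 → ℝ) => H x k :=
    fun x k => (continuous_apply k).comp (continuous_eval_const x)
  have hS : IsClosed S := by
    have h1 : IsClosed {H : C(Gasket T, Fin 3 → ℝ) | ∀ k x, 0 ≤ H x k} := by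
      simp only [Set.ofPred_forall]
      exact isClosed_iInter fun k => isClosed_iInter fun x => isClosed_le continuous_const (hc x k)
    have h2 : IsClosed {H : C(Gasket T, Fin 3 → ℝ) | ∀ x, ∑ k, H x k = 1} := by
      simp only [Set.ofPred_forall]
      exact isClosed_iInter fun x =>
        isClosed_eq (continuous_finsetSum _ fun k _ => hc x k) continuous_const
    have h3 : IsClosed {H : C(Gasket T, Fin 3 → ℝ) |
        ∀ k j, H (vertex T j) k = if k = j then 1 else 0} := by
      simp only [Set.ofPred_forall]
      exact isClosed_iInter fun k => isClosed_iInter fun j => isClosed_eq (hc _ k) continuous_const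
    exact h1.inter (h2.inter h3)
  have hbary : (⟨fun x k => bary T k x, continuous_pi fun k =>
      (continuous_bary k).comp continuous_subtype_val⟩ : C(Gasket T, Fin 3 → ℝ)) ∈ S :=
    ⟨fun k x => bary_nonneg k x, fun x => sum_bary (x : Plane), fun k j => bary_points k j⟩
  -- On `K_i` the `i`-th function has boundary values 1, 2/5, 2/5. The `k`-th, for `k ≠ i`, has 0 at
  -- `p_i`, 2/5 at the image of `p_k` and 1/5 at the third vertex. The sum being 1 removes one
  -- component of `H` from these combinations.
  let g : C(Gasket T, Fin 3 → ℝ) → Fin 3 → C(Gasket T, Fin 3 → ℝ) := fun H i =>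
    ⟨fun x k => if k = i then (2 + 3 * H x i) / 5 else (1 + H x k - H x i) / 5, by
      refine continuous_pi fun k => ?_
      split_ifs <;> fun_prop⟩
  have hglue : ∀ H : S, ∃ G : C(Gasket T, Fin 3 → ℝ), ∀ i x, G (contraction T i x) = g H.1 i x := by
    rintro ⟨H, -, -, hv⟩
    refine exists_glue _ fun i j => funext fun k => ?_
    change (if k = i then _ else _) = if k = j then _ else _
    simp only [hv]
    by_cases hij : i = j
    · rw [hij]
    · have hji := Ne.symm hij
      by_cases hki : k = i
      · subst hki; simp [hij, hji]; norm_num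
      · by_cases hkj : k = j
        · subst hkj; simp [hij, hji]; norm_num
        · simp [hij, hji, hki, hkj]
  choose Φ hΦ using hglue
  have hmem : ∀ H : S, Φ H ∈ S := by
    intro H
    obtain ⟨h0, hs, hv⟩ := H.2
    have h1 : ∀ x i, H.1 x i ≤ 1 := fun x i => by
      rw [← hs x]
      exact Finset.single_le_sum (fun k _ => h0 k x) (Finset.mem_univ i)
    refine ⟨fun k x => ?_, fun x => ?_, fun k j => ?_⟩
    · obtain ⟨i, y, rfl⟩ := exists_contraction_eq x
      rw [hΦ]
      change 0 ≤ if k = i then _ else _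
      split_ifs
      · linarith [h0 i y]
      · linarith [h0 k y, h1 y i]
    · obtain ⟨i, y, rfl⟩ := exists_contraction_eq x
      rw [hΦ]
      change ∑ k, (if k = i then _ else _) = _
      have := hs y
      rw [Fin.sum_univ_three] at this ⊢
      fin_cases i <;> simp <;> linarith
    · rw [← contraction_vertex T j, hΦ]
      change (if k = j then _ else _) = _
      simp only [hv, if_true]
      split_ifs <;> norm_num
  -- On `K_i` the component `i` is scaled by 3/5, and the others change by at most 1/5 + 1/5.
  have hlip : LipschitzWith (3 / 5) fun H : S => (⟨Φ H, hmem H⟩ : S) := by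
    refine LipschitzWith.of_dist_le_mul fun H G => ?_
    change dist (Φ H) (Φ G) ≤ _ * dist H.1 G.1
    rw [ContinuousMap.dist_le (by positivity)]
    intro x
    rw [dist_pi_le_iff (by positivity)]
    intro k
    obtain ⟨i, y, rfl⟩ := exists_contraction_eq x
    rw [hΦ, hΦ]
    have hd : ∀ k, |H.1 y k - G.1 y k| ≤ dist H.1 G.1 := fun k =>
      (dist_le_pi_dist (H.1 y) (G.1 y) k).trans (ContinuousMap.dist_apply_le_dist y)
    have h1 := abs_le.1 (hd k)
    have h2 := abs_le.1 (hd i)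
    change |(if k = i then _ else _) - if k = i then _ else _| ≤ _
    have : ((3 / 5 : ℝ≥0) : ℝ) = 3 / 5 := by norm_num
    rw [this]
    split_ifs <;> rw [abs_le] <;> constructor <;> linarith
  have : CompleteSpace S := hS.completeSpace_coe
  have : Nonempty S := ⟨⟨_, hbary⟩⟩
  have hcon : ContractingWith (3 / 5) fun H : S => (⟨Φ H, hmem H⟩ : S) :=
    ⟨by norm_num [← NNReal.coe_lt_coe], hlip⟩
  obtain ⟨h0, hs, hv⟩ := (hcon.fixedPoint).2
  have hfix : Φ hcon.fixedPoint = hcon.fixedPoint.1 :=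
    congrArg Subtype.val hcon.fixedPoint_isFixedPt
  refine ⟨hcon.fixedPoint.1, h0, hs, hv, fun i x k => ?_⟩
  conv_lhs => rw [← hfix, hΦ]
  rfl

/-- The map into `ℝ³` whose components are the harmonic functions with boundary values `δ`. -/
def harmonicBasis (T : Affine.Triangle ℝ Plane) : C(Gasket T, Fin 3 → ℝ) :=
  (exists_harmonic_basis T).choose

lemma harmonicBasis_nonneg (k : Fin 3) (x : Gasket T) : 0 ≤ harmonicBasis T x k :=
  (exists_harmonic_basis T).choose_spec.1 k x

lemma sum_harmonicBasis (x : Gasket T) : ∑ k, harmonicBasis T x k = 1 :=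
  (exists_harmonic_basis T).choose_spec.2.1 x

lemma harmonicBasis_vertex (k j : Fin 3) :
    harmonicBasis T (vertex T j) k = if k = j then 1 else 0 :=
  (exists_harmonic_basis T).choose_spec.2.2.1 k j

lemma harmonicBasis_contraction (i : Fin 3) (x : Gasket T) (k : Fin 3) :
    harmonicBasis T (contraction T i x) k = if k = i then (2 + 3 * harmonicBasis T x i) / 5
      else (1 + harmonicBasis T x k - harmonicBasis T x i) / 5 :=
  (exists_harmonic_basis T).choose_spec.2.2.2 i x k

/-- The harmonic function with boundary values `a`. -/
def harmonicExt (T : Affine.Triangle ℝ Plane) (a : Fin 3 → ℝ) : C(Gasket T, ℝ) :=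
  ⟨fun x => ∑ k, a k * harmonicBasis T x k, by fun_prop⟩

lemma harmonicExt_apply (a : Fin 3 → ℝ) (x : Gasket T) :
    harmonicExt T a x = ∑ k, a k * harmonicBasis T x k := rfl

lemma harmonicExt_vertex (a : Fin 3 → ℝ) (j : Fin 3) : harmonicExt T a (vertex T j) = a j := by
  simp [harmonicExt_apply, harmonicBasis_vertex]

/-- The boundary values on the cell `K_i` of the harmonic function with boundary values `a`. -/
def cellValues (i : Fin 3) (a : Fin 3 → ℝ) (j : Fin 3) : ℝ :=
  if j = i then a i else (a i + a j + ∑ k, a k) / 5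

/-- The fixed-point equation of the harmonic basis, summed against `a`: as the sum runs over all
three indices, `cellValues` is the rule `(2 a_i + 2 a_j + a_k) / 5` at midpoints. -/
lemma harmonicExt_contraction (a : Fin 3 → ℝ) (i : Fin 3) (x : Gasket T) :
    harmonicExt T a (contraction T i x) = harmonicExt T (cellValues i a) x := by
  simp only [harmonicExt_apply, harmonicBasis_contraction, cellValues]
  have hs := sum_harmonicBasis x
  simp only [Fin.sum_univ_three] at hs ⊢
  have h0 : harmonicBasis T x 0 = 1 - harmonicBasis T x 1 - harmonicBasis T x 2 := by linarith
  fin_cases i <;> simp <;> rw [h0] <;> ring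

/-- Every harmonic function on a cell extends to one on `K`; this transports null sets to cells. The
witness solves the `2 × 2` system for the two values away from `p_i`. -/
lemma cellValues_surjective (i : Fin 3) : Function.Surjective (cellValues i) := by
  intro b
  refine ⟨fun j => if j = i then b i else
    5 * b j + b i - 5 / 3 * ∑ k, b k, funext fun j => ?_⟩
  simp only [cellValues, Fin.sum_univ_three]
  fin_cases i <;> fin_cases j <;> simp <;> ring

/-! ### Energy of harmonic functions -/

lemma discreteEnergy_one (u : Gasket T → ℝ) :
    discreteEnergy T 1 u = 5 / 3 * ∑ i, discreteEnergy T 0 (fun x => u (contraction T i x)) :=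
  discreteEnergy_succ T 0 u

/-- The increment `E_1 - E_0` is a quadratic form in the deviation of the midpoint values from the
2/5, 2/5, 1/5 rule, and subtracting a harmonic function does not change this deviation. -/
lemma discreteEnergy_one_sub_harmonicExt (f : Gasket T → ℝ) (a : Fin 3 → ℝ) :
    discreteEnergy T 1 (fun x => f x - harmonicExt T a x) = discreteEnergy T 1 f -
      discreteEnergy T 0 f + discreteEnergy T 0 (fun x => f x - harmonicExt T a x) := by
  simp only [discreteEnergy_one, discreteEnergy_zero, Fin.sum_univ_three, contraction_vertex,
    harmonicExt_contraction, harmonicExt_vertex]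
  rw [contraction_vertex_comm T 1 0, contraction_vertex_comm T 2 0, contraction_vertex_comm T 2 1]
  simp [cellValues, Fin.sum_univ_three]
  ring

/-- Harmonic functions are orthogonal in the discrete energies to functions vanishing at the
boundary vertices. -/
lemma discreteEnergy_sub_harmonicExt (n : ℕ) : ∀ (f : Gasket T → ℝ) (a : Fin 3 → ℝ),
    discreteEnergy T n (fun x => f x - harmonicExt T a x) = discreteEnergy T n f -
      discreteEnergy T 0 f + discreteEnergy T 0 (fun x => f x - harmonicExt T a x) := by
  induction n with
  | zero => intro f a; ring
  | succ n ih =>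
    intro f a
    have h1 := discreteEnergy_one_sub_harmonicExt f a
    simp only [discreteEnergy_one] at h1
    -- The restriction of a harmonic function to a cell is harmonic, so `ih` applies in each cell;
    -- `h1` trades the level-one terms that remain for level-zero ones.
    simp only [discreteEnergy_succ, harmonicExt_contraction, ih, Finset.sum_add_distrib,
      Finset.sum_sub_distrib, mul_add, mul_sub] at h1 ⊢
    linarith

lemma discreteEnergy_harmonicExt (n : ℕ) (a : Fin 3 → ℝ) :
    discreteEnergy T n (harmonicExt T a) = discreteEnergy T 0 (harmonicExt T a) := by
  -- With `f = 2u`, `u` the harmonic function, the identity reads `E_n(u) = 4 E_n(u) - 4 E_0(u) +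
  -- E_0(u)`.
  have h1 := discreteEnergy_sub_harmonicExt n ((2 : ℝ) • ⇑(harmonicExt T a)) a
  have h2 : (fun x => ((2 : ℝ) • ⇑(harmonicExt T a)) x - harmonicExt T a x) =
      harmonicExt T a := by
    funext x; simp; ring
  rw [h2, discreteEnergy_smul, discreteEnergy_smul] at h1
  linarith

lemma finiteEnergy_harmonicExt (a : Fin 3 → ℝ) : FiniteEnergy T (harmonicExt T a) :=
  finiteEnergy_of_tendsto_le tendsto_const_nhds fun n => (discreteEnergy_harmonicExt n a).le

lemma energy_harmonicExt (a : Fin 3 → ℝ) :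
    energy T (harmonicExt T a) = discreteEnergy T 0 (harmonicExt T a) :=
  tendsto_nhds_unique (finiteEnergy_harmonicExt a).tendsto
    (tendsto_const_nhds.congr fun n => (discreteEnergy_harmonicExt n a).symm)

lemma FiniteEnergy.discreteEnergy_le {u : Gasket T → ℝ} (hu : FiniteEnergy T u) (n : ℕ) :
    discreteEnergy T n u ≤ energy T u := le_ciSup hu n

/-- The harmonic function with boundary values `a`, as an element of `F`. -/
def harmonicF (T : Affine.Triangle ℝ Plane) (a : Fin 3 → ℝ) : energyDomain T :=
  ⟨harmonicExt T a, finiteEnergy_harmonicExt a⟩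

/-- The energy equals `E_0`, which depends only on the boundary values and is a lower bound for the
energy of any competitor. -/
lemma isHarmonic_harmonicF (a : Fin 3 → ℝ) : IsHarmonic (harmonicF T a) := by
  intro v hv
  refine le_trans (le_of_eq ?_) (FiniteEnergy.discreteEnergy_le v.2 0)
  change energy T (harmonicExt T a) = _
  rw [energy_harmonicExt, discreteEnergy_zero, discreteEnergy_zero, hv, hv, hv]
  rfl

lemma finiteEnergy_of_comp_contraction {u : Gasket T → ℝ}
    (hu : ∀ i, FiniteEnergy T (fun x => u (contraction T i x))) : FiniteEnergy T u := by
  refine finiteEnergy_of_tendsto_le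
    (tendsto_const_nhds (x := 5 / 3 * ∑ i, energy T (fun x => u (contraction T i x)))) fun n => ?_
  refine (discreteEnergy_le_succ T n u).trans ?_
  rw [discreteEnergy_succ]
  gcongr with i _
  exact (hu i).discreteEnergy_le n

/-- Pythagoras in the limit: the difference vanishes at the boundary, so its `E_0` term drops out.
-/
lemma energy_sub_harmonicExt {u : Gasket T → ℝ} (hu : FiniteEnergy T u) :
    energy T (fun x => u x - harmonicExt T (fun j => u (vertex T j)) x) =
      energy T u - discreteEnergy T 0 u := by
  refine tendsto_nhds_unique (hu.sub (finiteEnergy_harmonicExt _)).tendsto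
    ((hu.tendsto.sub_const _).congr fun n => ?_)
  refine Eq.trans ?_ (discreteEnergy_sub_harmonicExt n u _).symm
  simp [discreteEnergy_zero (T := T) (fun x => u x - harmonicExt T _ x), harmonicExt_vertex]

lemma energy_comp_contraction_le {u : Gasket T → ℝ} (hu : FiniteEnergy T u) (i : Fin 3) :
    energy T (fun x => u (contraction T i x)) ≤ 3 / 5 * energy T u := by
  rw [energy_self_similar hu]
  have := Finset.single_le_sum (f := fun i => energy T (fun x => u (contraction T i x)))
    (fun i _ => energy_nonneg _) (Finset.mem_univ i)
  linarith

lemma sq_vertex_sub_vertex_le (u : Gasket T → ℝ) (i j : Fin 3) :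
    (u (vertex T i) - u (vertex T j)) ^ 2 ≤ discreteEnergy T 0 u := by
  rw [discreteEnergy_zero]
  have h1 := sq_nonneg (u (vertex T 0) - u (vertex T 1))
  have h2 := sq_nonneg (u (vertex T 0) - u (vertex T 2))
  have h3 := sq_nonneg (u (vertex T 1) - u (vertex T 2))
  fin_cases i <;> fin_cases j <;> simp <;> nlinarith

/-- Chaining through nested cells: each level costs `√E` of the current restriction, and these costs
decay geometrically. The bound `ε` on level-`n` oscillation serves only to stop the induction. -/
lemma abs_sub_le_of_osc (n : ℕ) : ∀ {u : Gasket T → ℝ} {ε : ℝ}, FiniteEnergy T u →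
    (∀ (w : Fin n → Fin 3) (x y : Gasket T), |u (cellMap T n w x) - u (cellMap T n w y)| ≤ ε) →
    ∀ x, |u x - u (vertex T 0)| ≤ 5 * √(energy T u) + ε := by
  induction n with
  | zero =>
    intro u ε _ h x
    have := h Fin.elim0 x (vertex T 0)
    simp only [cellMap] at this
    linarith [Real.sqrt_nonneg (energy T u)]
  | succ n ih =>
    intro u ε hu h x
    obtain ⟨i, y, rfl⟩ := exists_contraction_eq x
    have h1 := ih (hu.comp_contraction i) (ε := ε) (fun w x y => by
      have := h (Fin.cons i w) x y
      rwa [cellMap_cons, cellMap_cons] at this) y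
    -- Both points are vertices of the cell `K_0`, as `φ_i p_0 = φ_0 p_i` and `p_0 = φ_0 p_0`.
    have h2 : |u (contraction T i (vertex T 0)) - u (vertex T 0)| ≤ √(energy T u) := by
      refine Real.abs_le_sqrt ?_
      have := sq_vertex_sub_vertex_le (fun x => u (contraction T 0 x)) i 0
      rw [contraction_vertex, contraction_vertex_comm T 0 i] at this
      have h3 := (hu.comp_contraction 0).discreteEnergy_le 0
      have h4 := energy_comp_contraction_le hu 0
      have := energy_nonneg u
      linarith
    -- A cell carries at most 3/5 of the energy after restriction, and `25 · 3/5 = 15 ≤ 16`.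
    have h3 : 5 * √(energy T fun x => u (contraction T i x)) ≤ 4 * √(energy T u) := by
      have h4 := energy_comp_contraction_le hu i
      have h5 := Real.sq_sqrt (energy_nonneg u)
      have h6 := Real.sq_sqrt (energy_nonneg fun x => u (contraction T i x))
      refine le_of_sq_le_sq ?_ (by positivity)
      have := energy_nonneg u
      nlinarith
    have := abs_sub_le (u (contraction T i y)) (u (contraction T i (vertex T 0)))
      (u (vertex T 0))
    linarith

lemma exists_osc_cellMap_le (f : C(Gasket T, ℝ)) {ε : ℝ} (hε : 0 < ε) :
    ∃ n, ∀ (w : Fin n → Fin 3) (x y : Gasket T),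
      |f (cellMap T n w x) - f (cellMap T n w y)| ≤ ε := by
  obtain ⟨δ, hδ, H⟩ := Metric.uniformContinuous_iff.1
    (CompactSpace.uniformContinuous_of_continuous f.continuous) ε hε
  obtain ⟨N, hN⟩ : ∃ N : ℕ, (1 / 2 : ℝ) ^ N * Metric.diam (Set.univ : Set (Gasket T)) < δ := by
    have : Tendsto (fun n : ℕ => (1 / 2 : ℝ) ^ n * Metric.diam (Set.univ : Set (Gasket T))) atTop
        (𝓝 (0 * _)) :=
      (tendsto_pow_atTop_nhds_zero_of_lt_one (by norm_num) (by norm_num)).mul_const _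
    rw [zero_mul] at this
    exact (this.eventually_lt_const hδ).exists
  refine ⟨N, fun w x y => (H ?_).le⟩
  rw [dist_cellMap]
  refine lt_of_le_of_lt ?_ hN
  gcongr
  exact Metric.dist_le_diam_of_mem isCompact_univ.isBounded (Set.mem_univ _) (Set.mem_univ _)

lemma abs_sub_vertex_le (u : energyDomain T) (x : Gasket T) :
    |u.1 x - u.1 (vertex T 0)| ≤ 5 * √(energy T u.1) := by
  refine le_of_forall_pos_le_add fun ε hε => ?_
  obtain ⟨n, hn⟩ := exists_osc_cellMap_le u.1 hε
  exact abs_sub_le_of_osc n u.2 hn x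

/-! ### Self-similarity of energy measures and energy dominance of the Kusuoka measure -/

/-- The restriction `f ∘ φ_i` of `f ∈ F` to a cell. -/
def cellRestrict (i : Fin 3) (f : energyDomain T) : energyDomain T :=
  ⟨f.1.comp ⟨contraction T i, continuous_contraction i⟩, FiniteEnergy.comp_contraction f.2 i⟩

lemma cellRestrict_harmonicF (i : Fin 3) (a : Fin 3 → ℝ) :
    cellRestrict i (harmonicF T a) = harmonicF T (cellValues i a) :=
  Subtype.ext (ContinuousMap.ext fun x => harmonicExt_contraction a i x)

/-- The Riemann sums of level `n + 1` split according to the first letter of the word. -/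
lemma energyMeasure_eq_sum (f : energyDomain T) :
    energyMeasure f = (5 / 3 : ℝ≥0) •
      ∑ i, (energyMeasure (cellRestrict i f)).map (contraction T i) := by
  refine finite_measure_ext fun k => ?_
  have hk : ∀ i, Integrable (fun x => k x)
      ((energyMeasure (cellRestrict i f)).map (contraction T i)) :=
    fun i => integrable_of_continuous _ k
  rw [integral_smul_nnreal_measure, integral_finsetSum_measure fun i _ => hk i]
  simp_rw [integral_map (continuous_contraction _).measurable.aemeasurable
    k.continuous.aestronglyMeasurable]
  refine tendsto_nhds_unique
    ((tendsto_integral_energyMeasure f k).comp (tendsto_add_atTop_nat 1)) ?_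
  have := (tendsto_finsetSum Finset.univ fun i _ =>
    tendsto_integral_energyMeasure (cellRestrict i f)
    (k.comp ⟨contraction T i, continuous_contraction i⟩)).const_mul (5 / 3 : ℝ)
  convert this using 1
  · funext n
    exact riemannSum_succ f.1 k n
  · simp [NNReal.smul_def]

lemma energyMeasure_eq_zero_iff (f : energyDomain T) {A : Set (Gasket T)} (hA : MeasurableSet A) :
    energyMeasure f A = 0 ↔
      ∀ i, energyMeasure (cellRestrict i f) (contraction T i ⁻¹' A) = 0 := by
  rw [energyMeasure_eq_sum f]
  simp [Measure.map_apply (continuous_contraction _).measurable hA]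

lemma energy_parallelogram {f g : Gasket T → ℝ} (hf : FiniteEnergy T f) (hg : FiniteEnergy T g) :
    energy T (f + g) + energy T (f - g) = 2 * energy T f + 2 * energy T g := by
  refine tendsto_nhds_unique ((hf.add hg).tendsto.add (hf.sub hg).tendsto)
    (((hf.tendsto.const_mul 2).add (hg.tendsto.const_mul 2)).congr fun n => ?_)
  simp only [discreteEnergy, Finset.mul_sum, ← Finset.sum_add_distrib, Pi.add_apply, Pi.sub_apply]
  refine Finset.sum_congr rfl fun w _ => Finset.sum_congr rfl fun i _ =>
    Finset.sum_congr rfl fun j _ => ?_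
  ring

lemma energyMeasure_parallelogram (f g : energyDomain T) :
    energyMeasure (f + g) + energyMeasure (f - g) =
      (2 : ℝ≥0) • (energyMeasure f + energyMeasure g) := by
  refine finite_measure_ext fun k => ?_
  simp only [integral_add_measure, integrable_of_continuous, integral_smul_nnreal_measure,
    NNReal.smul_def, smul_eq_mul]
  refine tendsto_nhds_unique ((tendsto_integral_energyMeasure (f + g) k).add
    (tendsto_integral_energyMeasure (f - g) k)) (Tendsto.congr (fun n => ?_)
    (((tendsto_integral_energyMeasure f k).add
    (tendsto_integral_energyMeasure g k)).const_mul _))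
  simp only [riemannSum, ← Finset.sum_add_distrib, Finset.mul_sum]
  refine Finset.sum_congr rfl fun w _ => ?_
  have := energy_parallelogram (FiniteEnergy.comp_cellMap n f.2 w)
    (FiniteEnergy.comp_cellMap n g.2 w)
  change _ = k _ * (_ * energy T ((fun x => f.1 (cellMap T n w x)) +
    fun x => g.1 (cellMap T n w x))) + k _ * (_ * energy T ((fun x => f.1 (cellMap T n w x)) -
    fun x => g.1 (cellMap T n w x)))
  rw [NNReal.coe_ofNat]
  linear_combination (-k (cellMap T n w (vertex T 0)) * (5 / 3 : ℝ) ^ n) * this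

/-- The parallelogram identity with `ν_{f-g}` dropped; the factor 2 is harmless for null sets and
for limits. -/
lemma energyMeasure_add_le (f g : energyDomain T) (A : Set (Gasket T)) :
    energyMeasure (f + g) A ≤ 2 * (energyMeasure f A + energyMeasure g A) := by
  have h : energyMeasure (f + g) A + energyMeasure (f - g) A =
      2 * (energyMeasure f A + energyMeasure g A) := by
    simpa [ENNReal.smul_def, mul_add] using
      congrArg (fun μ : Measure (Gasket T) => μ A) (energyMeasure_parallelogram f g)
  exact h ▸ le_self_add

lemma energyMeasure_real_univ (f : energyDomain T) :
    (energyMeasure f).real Set.univ = energy T f.1 := by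
  have h1 := tendsto_integral_energyMeasure f 1
  have h2 : ∀ n, riemannSum T f.1 (1 : C(Gasket T, ℝ)) n = energy T f.1 := fun n => by
    -- A constant integrand has oscillation zero, so every Riemann sum is already exact.
    have := riemannSum_bound n f.2 (f := (1 : C(Gasket T, ℝ))) (c := 1) (ε := 0) (by simp)
    rw [zero_mul, one_mul] at this
    exact sub_eq_zero.1 (abs_nonpos_iff.1 this)
  have := tendsto_nhds_unique (tendsto_const_nhds.congr fun n => (h2 n).symm) h1
  rw [this]
  simp

lemma energyMeasure_univ (f : energyDomain T) :
    energyMeasure f Set.univ = ENNReal.ofReal (energy T f.1) := by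
  rw [← energyMeasure_real_univ, ofReal_measureReal]

/-- A set is null for the energy measures of all harmonic functions. -/
def IsHarmonicNull (A : Set (Gasket T)) : Prop := ∀ a, energyMeasure (harmonicF T a) A = 0

/-- Any harmonic function is the restriction to the cell `K_i` of a harmonic function on `K`, whose
energy measure gives `A` mass zero. -/
lemma IsHarmonicNull.preimage_contraction {A : Set (Gasket T)} (hA : MeasurableSet A)
    (h : IsHarmonicNull A) (i : Fin 3) : IsHarmonicNull (contraction T i ⁻¹' A) := by
  intro a
  obtain ⟨b, rfl⟩ := cellValues_surjective i a
  rw [← cellRestrict_harmonicF]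
  exact (energyMeasure_eq_zero_iff _ hA).1 (h b) i

lemma IsHarmonicNull.preimage_cellMap (n : ℕ) : ∀ {A : Set (Gasket T)}, MeasurableSet A →
    IsHarmonicNull A → ∀ w : Fin n → Fin 3, IsHarmonicNull (cellMap T n w ⁻¹' A) := by
  induction n with
  | zero => intro A _ h w; exact h
  | succ n ih =>
    intro A hA h w
    exact ih (hA.preimage (continuous_contraction (w 0)).measurable)
      (h.preimage_contraction hA (w 0)) _

lemma not_isHarmonicNull_univ : ¬ IsHarmonicNull (Set.univ : Set (Gasket T)) := by
  intro h
  -- Boundary values 1, 0, 0 give total mass `E_0 = 2`.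
  have h1 := h (fun k => if k = 0 then 1 else 0)
  rw [energyMeasure_univ, ENNReal.ofReal_eq_zero] at h1
  change energy T (harmonicExt T _) ≤ 0 at h1
  rw [energy_harmonicExt, discreteEnergy_zero] at h1
  simp only [harmonicExt_vertex] at h1
  norm_num [show (2 : Fin 3) ≠ 0 by decide] at h1

lemma exists_cellMap_eq (n : ℕ) : ∀ x : Gasket T, ∃ w y, cellMap T n w y = x := by
  induction n with
  | zero => exact fun x => ⟨Fin.elim0, x, rfl⟩
  | succ n ih =>
    intro x
    obtain ⟨i, y, rfl⟩ := exists_contraction_eq x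
    obtain ⟨w, z, rfl⟩ := ih y
    exact ⟨Fin.cons i w, z, cellMap_cons T n i w z⟩

/-- Every continuous function is approximated by piecewise harmonic functions. -/
lemma exists_piecewise_harmonic (n : ℕ) : ∀ f : C(Gasket T, ℝ), ∃ g : energyDomain T,
    (∀ j, g.1 (vertex T j) = f (vertex T j)) ∧
    (∀ ε, (∀ (w : Fin n → Fin 3) (x y : Gasket T),
      |f (cellMap T n w x) - f (cellMap T n w y)| ≤ ε) → ∀ x, |f x - g.1 x| ≤ ε) ∧
    (FiniteEnergy T f → energy T (fun x => f x - g.1 x) = energy T f - discreteEnergy T n f) ∧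
    ∀ A, MeasurableSet A → IsHarmonicNull A → energyMeasure g A = 0 := by
  -- Interpolation at the vertices is what permits gluing. The uniform bound gives density in
  -- `C(K)`, the energy identity gives approximation in energy, and the last clause carries null
  -- sets over to the approximants.
  induction n with
  | zero =>
    intro f
    refine ⟨harmonicF T fun j => f (vertex T j), fun j => harmonicExt_vertex _ j,
      fun ε hε x => ?_, fun hf => energy_sub_harmonicExt hf, fun A _ h => h _⟩
    change |f x - ∑ k, f (vertex T k) * harmonicBasis T x k| ≤ ε
    -- The harmonic basis is a partition of unity, so the error is an average of the differences `f
    -- x - f p_k`.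
    have h1 : f x - ∑ k, f (vertex T k) * harmonicBasis T x k =
        ∑ k, (f x - f (vertex T k)) * harmonicBasis T x k := by
      simp only [sub_mul, Finset.sum_sub_distrib, ← Finset.mul_sum, sum_harmonicBasis, mul_one]
    rw [h1]
    calc _ ≤ ∑ k, |(f x - f (vertex T k)) * harmonicBasis T x k| :=
          Finset.abs_sum_le_sum_abs _ _
      _ ≤ ∑ k, ε * harmonicBasis T x k := by
          gcongr with k _
          rw [abs_mul, abs_of_nonneg (harmonicBasis_nonneg k x)]
          exact mul_le_mul_of_nonneg_right (hε Fin.elim0 x (vertex T k)) (harmonicBasis_nonneg k x)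
      _ = ε := by rw [← Finset.mul_sum, sum_harmonicBasis, mul_one]
  | succ n ih =>
    intro f
    -- Each `f ∘ φ_i` is approximated separately; the pieces agree at the junctions because they
    -- interpolate `f` there.
    choose g hv hosc hen hnull using fun i : Fin 3 =>
      ih (f.comp ⟨contraction T i, continuous_contraction i⟩)
    obtain ⟨G, hG⟩ := exists_glue (fun i => (g i).1) fun i j => by
      rw [hv, hv]
      exact congrArg f (contraction_vertex_comm T i j)
    have hGF : FiniteEnergy T G := finiteEnergy_of_comp_contraction fun i => by
      simp only [hG]; exact (g i).2
    have hcell : ∀ i, cellRestrict i ⟨G, hGF⟩ = g i := fun i =>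
      Subtype.ext (ContinuousMap.ext fun x => hG i x)
    refine ⟨⟨G, hGF⟩, fun j => ?_, fun ε hε x => ?_, fun hf => ?_, fun A hA h => ?_⟩
    · change G _ = _
      conv_lhs => rw [← contraction_vertex T j, hG, hv]
      exact congrArg f (contraction_vertex T j)
    · obtain ⟨i, y, rfl⟩ := exists_contraction_eq x
      change |_ - G _| ≤ _
      rw [hG]
      refine hosc i ε (fun w x y => ?_) y
      have := hε (Fin.cons i w) x y
      rwa [cellMap_cons, cellMap_cons] at this
    · have h1 : FiniteEnergy T (fun x => f x - G x) := hf.sub hGF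
      change energy T (fun x => f x - G x) = _
      rw [energy_self_similar h1, energy_self_similar hf, discreteEnergy_succ, ← mul_sub,
        ← Finset.sum_sub_distrib]
      congr 1
      refine Finset.sum_congr rfl fun i _ => ?_
      simp only [hG]
      exact hen i (hf.comp_contraction i)
    · rw [energyMeasure_eq_zero_iff _ hA]
      intro i
      rw [hcell]
      exact hnull i _ (hA.preimage (continuous_contraction i).measurable)
        (h.preimage_contraction hA i)

/-- With `g` the level-`n` piecewise harmonic approximant, `ν_g(A) = 0`, so `ν_f(A)` is at most
twice the total mass of `ν_{f-g}`, that is `2 (E(f) - E_n(f))`, which tends to 0. -/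
lemma IsHarmonicNull.energyMeasure_eq_zero {A : Set (Gasket T)} (hA : MeasurableSet A)
    (h : IsHarmonicNull A) (f : energyDomain T) : energyMeasure f A = 0 := by
  have hf : FiniteEnergy T f.1 := f.2
  have h1 : ∀ n, energyMeasure f A ≤
      2 * ENNReal.ofReal (energy T f.1 - discreteEnergy T n f.1) := by
    intro n
    obtain ⟨g, -, -, hen, hnull⟩ := exists_piecewise_harmonic n f.1
    have h2 := energyMeasure_add_le g (f - g) A
    rw [add_sub_cancel, hnull A hA h, zero_add] at h2
    refine h2.trans ?_
    gcongr
    refine (measure_mono (Set.subset_univ A)).trans_eq ?_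
    rw [energyMeasure_univ, ← hen hf]
    rfl
  have h2 : Tendsto (fun n => 2 * ENNReal.ofReal (energy T f.1 - discreteEnergy T n f.1)) atTop
      (𝓝 (2 * ENNReal.ofReal (energy T f.1 - energy T f.1))) :=
    ENNReal.Tendsto.const_mul
      (ENNReal.tendsto_ofReal (tendsto_const_nhds.sub hf.tendsto)) (Or.inr (by simp))
  rw [sub_self, ENNReal.ofReal_zero, mul_zero] at h2
  exact le_antisymm (ge_of_tendsto' h2 h1) bot_le

variable {h : Fin 2 → energyDomain T}

/-- By completeness a harmonic function is a combination of `h_1`, `h_2` and a constant, and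
constants have zero energy measure. -/
lemma IsHarmonicONS.isHarmonicNull (hh : IsHarmonicONS h) {A : Set (Gasket T)}
    (hA : kusuoka h A = 0) : IsHarmonicNull A := by
  intro a
  obtain ⟨c, b, hb⟩ := hh.complete _ (isHarmonic_harmonicF a)
  have hdec : harmonicF T a =
      (b 0 • h 0 + b 1 • h 1) + (⟨ContinuousMap.const _ c, finiteEnergy_const c⟩ :
        energyDomain T) := by
    refine Subtype.ext (ContinuousMap.ext fun x => (hb x).trans ?_)
    rw [Fin.sum_univ_two, add_comm]
    rfl
  rw [kusuoka, Measure.add_apply, add_eq_zero] at hA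
  have hconst : energyMeasure
      (⟨ContinuousMap.const _ c, finiteEnergy_const c⟩ : energyDomain T) A = 0 := by
    refine measure_mono_null (Set.subset_univ A) ?_
    rw [energyMeasure_univ]
    have : ∀ n, discreteEnergy T n (fun _ => c) = 0 := fun n => by simp [discreteEnergy]
    change ENNReal.ofReal (⨆ n, discreteEnergy T n (fun _ => c)) = 0
    simp [this]
  have hlin : energyMeasure (b 0 • h 0 + b 1 • h 1) A = 0 := by
    refine le_antisymm ((energyMeasure_add_le _ _ A).trans_eq ?_) bot_le
    simp [energyMeasure_smul, hA.1, hA.2]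
  refine le_antisymm ?_ bot_le
  rw [hdec]
  refine (energyMeasure_add_le _ _ A).trans_eq ?_
  rw [hconst, hlin]
  simp

/-- The Kusuoka measure dominates all energy measures. -/
lemma IsHarmonicONS.absolutelyContinuous (hh : IsHarmonicONS h) (f : energyDomain T) :
    energyMeasure f ≪ kusuoka h :=
  Measure.AbsolutelyContinuous.mk fun _ hA h0 =>
    (hh.isHarmonicNull h0).energyMeasure_eq_zero hA f

/-- The Kusuoka measure has full support. -/
lemma IsHarmonicONS.isOpenPosMeasure (hh : IsHarmonicONS h) :
    (kusuoka h).IsOpenPosMeasure := by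
  refine ⟨fun U hU ⟨x, hx⟩ h0 => ?_⟩
  obtain ⟨ε, hε, hball⟩ := Metric.isOpen_iff.1 hU x hx
  have hlim : Tendsto (fun n : ℕ => (1 / 2 : ℝ) ^ n * Metric.diam (Set.univ : Set (Gasket T)))
      atTop (𝓝 (0 * _)) :=
    (tendsto_pow_atTop_nhds_zero_of_lt_one (by norm_num) (by norm_num)).mul_const _
  rw [zero_mul] at hlim
  obtain ⟨n, hn⟩ := (hlim.eventually_lt_const hε).exists
  obtain ⟨w, y, rfl⟩ := exists_cellMap_eq n x
  -- A small cell around `x` lies in `U`, so the preimage of `U` under its cell map is all of `K`,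
  -- which would then be null for every harmonic function.
  refine not_isHarmonicNull_univ (T := T) ?_
  convert (hh.isHarmonicNull h0).preimage_cellMap n hU.measurableSet w
  refine (Set.eq_univ_of_forall fun z => ?_).symm
  refine hball ?_
  rw [Metric.mem_ball, dist_cellMap]
  refine lt_of_le_of_lt ?_ hn
  gcongr
  exact Metric.dist_le_diam_of_mem isCompact_univ.isBounded (Set.mem_univ _) (Set.mem_univ _)

/-! ### Closed operators -/

section Closed

variable {E F : Type*} [NormedAddCommGroup E] [InnerProductSpace ℂ E] [CompleteSpace E]
  [NormedAddCommGroup F] [InnerProductSpace ℂ F] [CompleteSpace F] {A : E →ₗ.[ℂ] F}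

/-- A closed densely defined operator contains the adjoint of its adjoint. -/
lemma mem_graph_of_adjoint (hd : Dense (A.domain : Set E)) (hc : A.IsClosed) {x : E} {y : F}
    (hxy : ∀ w : A.adjoint.domain, inner ℂ x (A.adjoint w) = inner ℂ y (w : F)) :
    (x, y) ∈ A.graph := by
  let K : Submodule ℂ (WithLp 2 (E × F)) :=
    A.graph.comap (WithLp.linearEquiv 2 ℂ (E × F)).toLinearMap
  have hK : IsClosed (K : Set (WithLp 2 (E × F))) := hc.preimage (WithLp.prod_continuous_ofLp _ _ _)
  have : CompleteSpace K := hK.completeSpace_coe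
  -- The graph is a closed subspace of the Hilbert sum, hence equal to its double orthogonal
  -- complement.
  suffices h : WithLp.toLp 2 (x, y) ∈ K from h
  rw [← K.orthogonal_orthogonal, Submodule.mem_orthogonal]
  intro z hz
  rw [Submodule.mem_orthogonal] at hz
  -- Orthogonality of `z` to the graph says exactly that `A^* z_2 = -z_1`.
  have h1 : ∀ a : A.domain, inner ℂ (-z.fst) (a : E) = inner ℂ z.snd (A a) := by
    intro a
    have := hz (WithLp.toLp 2 ((a : E), A a)) (A.mem_graph a)
    rw [WithLp.prod_inner_apply] at this
    have h2 : inner ℂ (a : E) z.fst + inner ℂ (A a) z.snd = 0 := this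
    rw [inner_neg_left, ← inner_conj_symm, ← inner_conj_symm z.snd, ← map_neg]
    exact congrArg _ (neg_eq_of_add_eq_zero_right h2)
  have h2 : z.snd ∈ A.adjoint.domain := LinearPMap.mem_adjoint_domain_of_exists _ ⟨_, h1⟩
  have h3 : A.adjoint ⟨z.snd, h2⟩ = -z.fst := LinearPMap.adjoint_apply_eq hd _ h1
  have h4 := hxy ⟨z.snd, h2⟩
  rw [h3, inner_neg_right] at h4
  rw [WithLp.prod_inner_apply]
  change inner ℂ z.fst x + inner ℂ z.snd y = 0
  rw [← inner_conj_symm, ← inner_conj_symm z.snd, ← map_add, ← h4, add_neg_cancel, map_zero]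

/-- The adjoint of a closed densely defined operator is densely defined. -/
lemma dense_adjoint_domain (hd : Dense (A.domain : Set E)) (hc : A.IsClosed) :
    Dense (A.adjoint.domain : Set F) := by
  rw [Submodule.dense_iff_topologicalClosure_eq_top, Submodule.topologicalClosure_eq_top_iff,
    Submodule.eq_bot_iff]
  intro y hy
  -- A vector `y` orthogonal to `dom A^*` makes `(0, y)` pass the test for the graph of `A`, so `y =
  -- A 0 = 0`.
  have h1 : ((0 : E), y) ∈ A.graph := mem_graph_of_adjoint hd hc fun w => by
    rw [inner_zero_left, Submodule.inner_left_of_mem_orthogonal w.2 hy]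
  exact A.graph_fst_eq_zero_snd h1 rfl

end Closed

/-! ### Self-adjointness of the Dirac operator -/

lemma dirac_apply (z : (dirac h).domain) : dirac h z =
    WithLp.toLp 2 (Complex.I • (derivation h).adjoint ⟨z.1.snd, z.2.2⟩,
      -Complex.I • derivation h ⟨z.1.fst, z.2.1⟩) := by
  change WithLp.toLp 2 (-Complex.I • (-(derivation h).adjoint ⟨z.1.snd, z.2.2⟩), _) = _
  rw [smul_neg, neg_smul, neg_neg]

lemma inner_dirac (x : L2C h) (ω : OneForms h) (z : (dirac h).domain) :
    inner ℂ (WithLp.toLp 2 (x, ω) : DiracSpace h) (dirac h z) =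
      Complex.I * inner ℂ x ((derivation h).adjoint ⟨z.1.snd, z.2.2⟩) -
        Complex.I * inner ℂ ω (derivation h ⟨z.1.fst, z.2.1⟩) := by
  rw [dirac_apply, WithLp.prod_inner_apply]
  change inner ℂ x (Complex.I • _) + inner ℂ ω (-Complex.I • _) = _
  rw [inner_smul_right, inner_smul_right]
  ring

/-- The Dirac operator is self-adjoint if the derivation is closed and densely defined. -/
lemma isSelfAdjoint_dirac (hd : Dense ((derivation h).domain : Set (L2C h)))
    (hc : (derivation h).IsClosed) : IsSelfAdjoint (dirac h) := by
  have hd' := dense_adjoint_domain hd hc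
  have hadj := LinearPMap.adjoint_isFormalAdjoint hd
  have hdense : Dense ((dirac h).domain : Set (DiracSpace h)) := by
    have h1 : Dense (((derivation h).domain : Set (L2C h)) ×ˢ
        ((derivation h).adjoint.domain : Set (OneForms h))) := hd.prod hd'
    exact h1.preimage (WithLp.homeomorphProd 2 (L2C h) (OneForms h)).isOpenMap
  -- Formal adjointness of `A` and `A^*` exchanges the two terms, and `conj i = -i` restores their
  -- signs.
  have hsymm : (dirac h).IsFormalAdjoint (dirac h) := by
    intro y z
    have h1 := inner_dirac y.1.fst y.1.snd z
    have h2 := inner_dirac z.1.fst z.1.snd y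
    have e : ∀ v : DiracSpace h, WithLp.toLp 2 (v.fst, v.snd) = v := fun v => rfl
    rw [e] at h1 h2
    rw [h1, ← inner_conj_symm, h2, map_sub, map_mul, map_mul, Complex.conj_I, inner_conj_symm,
      inner_conj_symm]
    have h3 := hadj ⟨y.1.snd, y.2.2⟩ ⟨z.1.fst, z.2.1⟩
    have h4 := hadj.symm ⟨y.1.fst, y.2.1⟩ ⟨z.1.snd, z.2.2⟩
    simp only at h3 h4
    rw [h3, h4]
    ring
  have hle := LinearPMap.IsFormalAdjoint.le_adjoint hdense hsymm
  rw [LinearPMap.isSelfAdjoint_def]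
  -- Symmetry gives `D ⊆ D^*`; it remains to see `dom D^* ⊆ dom D`.
  refine (LinearPMap.eq_of_le_of_domain_eq hle (le_antisymm hle.1 fun v hv => ?_)).symm
  set r := (dirac h).adjoint ⟨v, hv⟩ with hr
  have key : ∀ z : (dirac h).domain, inner ℂ r (z : DiracSpace h) = inner ℂ v (dirac h z) :=
    fun z => LinearPMap.adjoint_isFormalAdjoint hdense ⟨v, hv⟩ z
  refine ⟨?_, ?_⟩
  · have h1 : (v.fst, Complex.I • r.snd) ∈ (derivation h).graph := by
      refine mem_graph_of_adjoint hd hc fun w => ?_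
      have h2 := key ⟨WithLp.toLp 2 (0, w.1), ⟨zero_mem _, w.2⟩⟩
      have h3 := inner_dirac v.fst v.snd ⟨WithLp.toLp 2 (0, w.1), ⟨zero_mem _, w.2⟩⟩
      rw [show (WithLp.toLp 2 (v.fst, v.snd) : DiracSpace h) = v from rfl, ← h2,
        WithLp.prod_inner_apply] at h3
      have h4 : derivation h ⟨0, zero_mem _⟩ = 0 := (derivation h).map_zero
      change inner ℂ r.fst 0 + inner ℂ r.snd (w : OneForms h) = Complex.I *
        inner ℂ v.fst ((derivation h).adjoint w) - Complex.I *
        inner ℂ v.snd (derivation h ⟨0, zero_mem _⟩) at h3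
      rw [h4, inner_zero_right, inner_zero_right, mul_zero, sub_zero, zero_add] at h3
      rw [inner_smul_left, Complex.conj_I, h3, ← mul_assoc, neg_mul, Complex.I_mul_I, neg_neg,
        one_mul]
    exact LinearPMap.mem_domain_of_mem_graph h1
  -- Testing against `(a, 0)` gives `⟨r_1, a⟩ = -i ⟨v_2, A a⟩`, that is `A^* v_2 = -i r_1`.
  · refine LinearPMap.mem_adjoint_domain_of_exists _ ⟨-(Complex.I • r.fst), fun a => ?_⟩
    have h2 := key ⟨WithLp.toLp 2 (a.1, 0), ⟨a.2, zero_mem _⟩⟩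
    have h3 := inner_dirac v.fst v.snd ⟨WithLp.toLp 2 (a.1, 0), ⟨a.2, zero_mem _⟩⟩
    rw [show (WithLp.toLp 2 (v.fst, v.snd) : DiracSpace h) = v from rfl, ← h2,
      WithLp.prod_inner_apply] at h3
    have h4 : (derivation h).adjoint ⟨0, zero_mem _⟩ = 0 := (derivation h).adjoint.map_zero
    change inner ℂ r.fst (a : L2C h) + inner ℂ r.snd 0 = Complex.I *
      inner ℂ v.fst ((derivation h).adjoint ⟨0, zero_mem _⟩) - Complex.I *
      inner ℂ v.snd (derivation h a) at h3
    rw [h4, inner_zero_right, inner_zero_right, mul_zero, zero_sub, add_zero] at h3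
    change inner ℂ _ _ = inner ℂ v.snd (derivation h a)
    rw [inner_neg_left, inner_smul_left, Complex.conj_I, h3, neg_mul, neg_neg, mul_neg,
      ← mul_assoc, Complex.I_mul_I]
    ring

/-! ### Density of the domain -/

/-- Continuous functions that agree almost everywhere for a measure of full support are equal. -/
lemma toL2_injective (hh : IsHarmonicONS h) : Function.Injective (toL2 h) := by
  have := hh.isOpenPosMeasure
  exact (ContinuousMap.toLp_injective (p := 2) (𝕜 := ℂ) (kusuoka h)).comp
    Subtype.val_injective

/-- The function `u + i v`. -/
def complexF (u v : energyDomain T) : energyDomainC T :=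
  ⟨⟨fun x => (u.1 x : ℂ) + (v.1 x : ℂ) * Complex.I, by fun_prop⟩, by
    constructor
    · convert u.2 using 1
      ext x; simp [rePart]
    · convert v.2 using 1
      ext x; simp [imPart]⟩

lemma exists_energyDomain_abs_sub_le (f : C(Gasket T, ℝ)) {ε : ℝ} (hε : 0 < ε) :
    ∃ g : energyDomain T, ∀ x, |f x - g.1 x| ≤ ε := by
  obtain ⟨n, hn⟩ := exists_osc_cellMap_le f hε
  obtain ⟨g, -, hg, -⟩ := exists_piecewise_harmonic n f
  exact ⟨g, hg ε hn⟩

/-- `F_ℂ` is uniformly dense in `C(K, ℂ)`. -/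
lemma dense_energyDomainC : Dense (energyDomainC T : Set C(Gasket T, ℂ)) := by
  intro f
  rw [Metric.mem_closure_iff]
  intro ε hε
  obtain ⟨u, hu⟩ := exists_energyDomain_abs_sub_le (rePart f) (ε := ε / 3) (by positivity)
  obtain ⟨v, hv⟩ := exists_energyDomain_abs_sub_le (imPart f) (ε := ε / 3) (by positivity)
  refine ⟨complexF u v, (complexF u v).2, ?_⟩
  refine lt_of_le_of_lt ((ContinuousMap.dist_le (C := 2 * ε / 3) (by positivity)).2 fun x => ?_)
    (by linarith)
  rw [dist_eq_norm]
  refine (Complex.norm_le_abs_re_add_abs_im _).trans ?_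
  have h1 : (f x - (complexF u v).1 x).re = rePart f x - u.1 x := by simp [complexF, rePart]
  have h2 : (f x - (complexF u v).1 x).im = imPart f x - v.1 x := by simp [complexF, imPart]
  rw [h1, h2]
  linarith [hu x, hv x]

lemma derivation_domain :
    ((derivation h).domain : Set (L2C h)) = Set.range (toL2 h) := by
  ext φ
  simp [derivation, Submodule.toLinearPMap_domain]

lemma dense_derivation_domain : Dense ((derivation h).domain : Set (L2C h)) := by
  rw [derivation_domain]
  have h1 : DenseRange (ContinuousMap.toLp (α := Gasket T) (E := ℂ) 2 (kusuoka h) ℂ) :=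
    ContinuousMap.toLp_denseRange ℂ (kusuoka h) ℂ (by norm_num)
  exact h1.comp dense_energyDomainC.denseRange_val (ContinuousLinearMap.continuous _)

/-! ### The norm of the derivation -/

/-- Absolute continuity enters here: in general the density only recovers the absolutely continuous
part of the energy measure. -/
lemma integral_density (hh : IsHarmonicONS h) (f : energyDomain T) :
    ∫ x, density h f x ∂(kusuoka h) = energy T f.1 :=
  (Measure.integral_toReal_rnDeriv (hh.absolutelyContinuous f)).trans (energyMeasure_real_univ f)

lemma integral_gamma_self (hh : IsHarmonicONS h) (f : energyDomain T) :
    ∫ x, gamma h f f x ∂(kusuoka h) = energy T f.1 := by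
  unfold gamma
  rw [integral_div, integral_sub (density_integrable h _) (density_integrable h _),
    integral_density hh, integral_density hh, sub_self, ← two_smul ℝ f, ← zero_smul ℝ f]
  have h1 := energy_smul f.2 2
  have h2 := energy_smul f.2 0
  change (energy T ((2 : ℝ) • ⇑f.1) - energy T ((0 : ℝ) • ⇑f.1)) / 4 = _
  rw [h1, h2]
  ring

/-- The mixed terms `± i Γ(Re f, Im f)` cancel by symmetry of `Γ`. -/
lemma norm_del_sq (hh : IsHarmonicONS h) (f : energyDomainC T) :
    ‖del h f‖ ^ 2 = energy T (reF f).1 + energy T (imF f).1 := by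
  have h1 : inner ℂ (del h f) (del h f) = ∫ x, ((gamma h (reF f) (reF f) x +
      gamma h (imF f) (imF f) x : ℝ) : ℂ) ∂(kusuoka h) := by
    refine (inner_tensor h f (oneC T) f (oneC T)).trans (integral_congr_ae ?_)
    refine Eventually.of_forall fun x => ?_
    have h2 : evalC (oneC T) x = 1 := rfl
    simp only [h2, map_one, one_mul, gammaC, gamma_symm h (imF f) (reF f)]
    push_cast
    ring
  rw [integral_complex_ofReal, integral_add (gamma_integrable h _ _) (gamma_integrable h _ _),
    integral_gamma_self hh, integral_gamma_self hh, inner_self_eq_norm_sq_to_K] at h1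
  exact Complex.ofReal_injective ((Complex.ofReal_pow _ _).trans h1)

/-! ### Completeness of the energy domain -/

/-- Lower semicontinuity: each discrete energy involves finitely many points, so it passes to
pointwise limits, and the energy is their supremum. -/
lemma energy_le_of_tendsto {u : ℕ → Gasket T → ℝ} {v : Gasket T → ℝ} {C : ℝ}
    (hu : ∀ x, Tendsto (fun n => u n x) atTop (𝓝 (v x)))
    (hC : ∀ᶠ n in atTop, FiniteEnergy T (u n) ∧ energy T (u n) ≤ C) :
    FiniteEnergy T v ∧ energy T v ≤ C := by
  have h1 : ∀ k, discreteEnergy T k v ≤ C := by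
    intro k
    have h2 : Tendsto (fun n => discreteEnergy T k (u n)) atTop (𝓝 (discreteEnergy T k v)) := by
      unfold discreteEnergy
      exact (tendsto_finsetSum _ fun w _ => tendsto_finsetSum _ fun i _ =>
        tendsto_finsetSum _ fun j _ => ((hu _).sub (hu _)).pow 2).const_mul _
    refine le_of_tendsto h2 (hC.mono fun n hn => (hn.1.discreteEnergy_le k).trans hn.2)
  exact ⟨⟨C, by rintro _ ⟨k, rfl⟩; exact h1 k⟩, ciSup_le h1⟩

lemma sqrt_energy_le_norm_del (hh : IsHarmonicONS h) (f : energyDomainC T) :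
    √(energy T (reF f).1) ≤ ‖del h f‖ ∧ √(energy T (imF f).1) ≤ ‖del h f‖ := by
  have h1 := norm_del_sq hh f
  constructor <;> refine Real.sqrt_le_iff.2 ⟨norm_nonneg _, ?_⟩ <;> rw [h1]
  · linarith [energy_nonneg (T := T) (imF f).1]
  · linarith [energy_nonneg (T := T) (reF f).1]

lemma norm_sub_vertex_le (hh : IsHarmonicONS h) (f : energyDomainC T) (x : Gasket T) :
    ‖f.1 x - f.1 (vertex T 0)‖ ≤ 10 * ‖del h f‖ := by
  refine (Complex.norm_le_abs_re_add_abs_im _).trans ?_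
  have h1 := abs_sub_vertex_le (reF f) x
  have h2 := abs_sub_vertex_le (imF f) x
  obtain ⟨h3, h4⟩ := sqrt_energy_le_norm_del hh f
  change |(f.1 x).re - (f.1 (vertex T 0)).re| ≤ _ at h1
  change |(f.1 x).im - (f.1 (vertex T 0)).im| ≤ _ at h2
  rw [Complex.sub_re, Complex.sub_im]
  linarith

/-- The graph norm of the derivation dominates the supremum norm. -/
lemma exists_norm_le_graph_norm (hh : IsHarmonicONS h) :
    ∃ C, 0 ≤ C ∧ ∀ f : energyDomainC T, ‖f.1‖ ≤ C * (‖toL2 h f‖ + ‖del h f‖) := by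
  set M := ‖(ContinuousMap.toLp (α := Gasket T) (E := ℂ) 2 (kusuoka h) ℂ)‖
  have hM : 0 ≤ M := norm_nonneg _
  set m := ‖toL2 h (oneC T)‖
  have hm : 0 < m := by
    refine norm_pos_iff.2 fun h0 => ?_
    have h1 := toL2_injective hh (h0.trans (map_zero _).symm)
    have h2 : (oneC T).1 (vertex T 0) = (0 : energyDomainC T).1 (vertex T 0) := by rw [h1]
    exact one_ne_zero h2
  -- Split `f` into the constant `c = f(p_0)` and a remainder of supremum norm at most `10 ‖∂f‖`.
  -- The `L²` norm of the constant is `‖c‖ m`, with `m > 0`, which bounds `‖c‖` by `(‖f‖_2 + 10 M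
  -- ‖∂f‖) / m`.
  refine ⟨1 / m + M * 10 / m + 10, by positivity, fun f => ?_⟩
  set c := f.1 (vertex T 0)
  have h1 : ‖(f - c • oneC T).1‖ ≤ 10 * ‖del h f‖ := by
    refine (ContinuousMap.norm_le _ (by positivity)).2 fun x => ?_
    have : (f - c • oneC T).1 x = f.1 x - c := by
      change f.1 x - c * 1 = _
      rw [mul_one]
    rw [this]
    exact norm_sub_vertex_le hh f x
  have h2 : ‖toL2 h (f - c • oneC T)‖ ≤ M * ‖(f - c • oneC T).1‖ :=
    (ContinuousMap.toLp (α := Gasket T) (E := ℂ) 2 (kusuoka h) ℂ).le_opNorm _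
  have h3 : ‖c‖ * m ≤ ‖toL2 h f‖ + M * (10 * ‖del h f‖) := by
    rw [← norm_smul, ← map_smul]
    have : c • oneC T = f - (f - c • oneC T) := by abel
    rw [this, map_sub]
    refine (norm_sub_le _ _).trans (add_le_add le_rfl (h2.trans ?_))
    gcongr
  have h4 : ‖c‖ ≤ 1 / m * ‖toL2 h f‖ + M * 10 / m * ‖del h f‖ := by
    have : ‖c‖ ≤ (‖toL2 h f‖ + M * (10 * ‖del h f‖)) / m := (le_div_iff₀ hm).2 h3
    refine this.trans_eq ?_
    ring
  have h5 : ‖f.1‖ ≤ ‖c‖ + 10 * ‖del h f‖ := by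
    refine (ContinuousMap.norm_le _ (by positivity)).2 fun x => ?_
    have h6 := norm_sub_vertex_le hh f x
    have h7 := norm_add_le (f.1 x - c) c
    rw [sub_add_cancel] at h7
    linarith
  have h8 : 0 ≤ M * 10 / m * ‖toL2 h f‖ := by positivity
  have h9 : 0 ≤ 1 / m * ‖del h f‖ := by positivity
  have h10 := norm_nonneg (toL2 h f)
  nlinarith

/-- The range is the graph of an operator because `f = 0` in `L²` forces `f = 0`, hence `∂f = 0`. -/
lemma derivation_graph (hh : IsHarmonicONS h) :
    (derivation h).graph = LinearMap.range ((toL2 h).prod (del h)) := by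
  refine Submodule.toLinearPMap_graph_eq _ ?_
  rintro _ ⟨f, rfl⟩ hf
  have : f = 0 := toL2_injective hh (Eq.trans hf (map_zero _).symm)
  rw [this, map_zero]
  rfl

lemma tendsto_apply_of_tendsto {u : ℕ → C(Gasket T, ℂ)} {v : C(Gasket T, ℂ)}
    (hu : Tendsto u atTop (𝓝 v)) (x : Gasket T) : Tendsto (fun n => u n x) atTop (𝓝 (v x)) :=
  ((continuous_eval_const x).tendsto v).comp hu

/-- The derivation is a closed operator. -/
lemma isClosed_derivation (hh : IsHarmonicONS h) : (derivation h).IsClosed := by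
  rw [LinearPMap.IsClosed, derivation_graph hh]
  refine IsSeqClosed.isClosed fun p q hp hpq => ?_
  choose f hf using hp
  have hf1 : Tendsto (fun n => toL2 h (f n)) atTop (𝓝 q.1) :=
    ((continuous_fst.tendsto q).comp hpq).congr fun n => congrArg Prod.fst (hf n).symm
  have hf2 : Tendsto (fun n => del h (f n)) atTop (𝓝 q.2) :=
    ((continuous_snd.tendsto q).comp hpq).congr fun n => congrArg Prod.snd (hf n).symm
  have hc1 := Metric.cauchySeq_iff.1 hf1.cauchySeq
  have hc2 := Metric.cauchySeq_iff.1 hf2.cauchySeq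
  obtain ⟨C, hC0, hC⟩ := exists_norm_le_graph_norm hh
  have hcauchy : CauchySeq fun n => (f n).1 := by
    rw [Metric.cauchySeq_iff]
    intro ε hε
    -- The `C + 1` keeps the denominator positive when `C = 0`; the two errors add up to `C / (C +
    -- 1) · ε`.
    obtain ⟨N1, hN1⟩ := hc1 (ε / (2 * (C + 1))) (by positivity)
    obtain ⟨N2, hN2⟩ := hc2 (ε / (2 * (C + 1))) (by positivity)
    refine ⟨max N1 N2, fun m hm n hn => ?_⟩
    have h1 := hN1 m (le_of_max_le_left hm) n (le_of_max_le_left hn)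
    have h2 := hN2 m (le_of_max_le_right hm) n (le_of_max_le_right hn)
    rw [dist_eq_norm, ← map_sub] at h1 h2
    rw [dist_eq_norm]
    refine lt_of_le_of_lt (hC (f m - f n)) ?_
    calc _ ≤ C * (ε / (2 * (C + 1)) + ε / (2 * (C + 1))) := by gcongr
      _ = C / (C + 1) * ε := by field_simp; ring
      _ < 1 * ε := by
        gcongr
        rw [div_lt_one (by positivity)]
        linarith
      _ = ε := one_mul ε
  obtain ⟨g, hg⟩ := cauchySeq_tendsto_of_complete hcauchy
  have hre : ∀ x, Tendsto (fun n => ((f n).1 x).re) atTop (𝓝 (g x).re) := fun x =>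
    (Complex.continuous_re.tendsto _).comp (tendsto_apply_of_tendsto hg x)
  have him : ∀ x, Tendsto (fun n => ((f n).1 x).im) atTop (𝓝 (g x).im) := fun x =>
    (Complex.continuous_im.tendsto _).comp (tendsto_apply_of_tendsto hg x)
  -- Semicontinuity is applied to `f_m - f_n` as `m → ∞` with `n` fixed; the energies are at most
  -- `‖∂(f_m - f_n)‖²`.
  have hbound : ∀ ε > 0, ∃ N, ∀ n ≥ N,
      (FiniteEnergy T (fun x => (g x).re - ((f n).1 x).re) ∧
        energy T (fun x => (g x).re - ((f n).1 x).re) ≤ ε ^ 2) ∧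
      (FiniteEnergy T (fun x => (g x).im - ((f n).1 x).im) ∧
        energy T (fun x => (g x).im - ((f n).1 x).im) ≤ ε ^ 2) := by
    intro ε hε
    obtain ⟨N, hN⟩ := hc2 ε hε
    refine ⟨N, fun n hn => ?_⟩
    have h1 : ∀ m ≥ N, ‖del h (f m - f n)‖ ^ 2 ≤ ε ^ 2 := fun m hm => by
      have := hN m hm n hn
      rw [dist_eq_norm, ← map_sub] at this
      gcongr
    simp only [norm_del_sq hh] at h1
    constructor
    · refine energy_le_of_tendsto (u := fun m x => ((f m).1 x).re - ((f n).1 x).re)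
        (fun x => (hre x).sub_const _) ?_
      filter_upwards [eventually_ge_atTop N] with m hm
      refine ⟨(f m - f n).2.1, le_trans ?_ (h1 m hm)⟩
      exact le_add_of_nonneg_right (energy_nonneg _)
    · refine energy_le_of_tendsto (u := fun m x => ((f m).1 x).im - ((f n).1 x).im)
        (fun x => (him x).sub_const _) ?_
      filter_upwards [eventually_ge_atTop N] with m hm
      refine ⟨(f m - f n).2.2, le_trans ?_ (h1 m hm)⟩
      exact le_add_of_nonneg_left (energy_nonneg _)
  have hgF : g ∈ energyDomainC T := by
    obtain ⟨N, hN⟩ := hbound 1 one_pos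
    obtain ⟨⟨h1, -⟩, h2, -⟩ := hN N le_rfl
    constructor
    · have key : ⇑(rePart g) = (fun x => (g x).re - ((f N).1 x).re) + ⇑(rePart (f N).1) := by
        funext x
        simp [rePart]
      change FiniteEnergy T _
      rw [key]
      exact h1.add (f N).2.1
    · have key : ⇑(imPart g) = (fun x => (g x).im - ((f N).1 x).im) + ⇑(imPart (f N).1) := by
        funext x
        simp [imPart]
      change FiniteEnergy T _
      rw [key]
      exact h2.add (f N).2.2
  refine ⟨⟨g, hgF⟩, Prod.ext ?_ ?_⟩
  · refine tendsto_nhds_unique (f := fun n => toL2 h (f n)) ?_ hf1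
    exact ((ContinuousMap.toLp (α := Gasket T) (E := ℂ) 2 (kusuoka h) ℂ).continuous.tendsto g).comp
      hg
  · refine tendsto_nhds_unique (f := fun n => del h (f n)) ?_ hf2
    rw [Metric.tendsto_atTop]
    intro ε hε
    -- Real and imaginary parts contribute at most `ε² / 4` each, and `ε² / 2 < ε²`.
    obtain ⟨N, hN⟩ := hbound (ε / 2) (by positivity)
    refine ⟨N, fun n hn => ?_⟩
    obtain ⟨⟨-, h1⟩, -, h2⟩ := hN n hn
    change dist _ (del h _) < ε
    rw [dist_comm, dist_eq_norm, ← map_sub]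
    have h3 := norm_del_sq hh (⟨g, hgF⟩ - f n)
    refine lt_of_pow_lt_pow_left₀ 2 hε.le ?_
    rw [h3]
    refine lt_of_le_of_lt (add_le_add h1 h2) ?_
    nlinarith

end SierpinskiGasket

end

/-- For every equilateral triangle, with the Kusuoka measure of any complete energy orthonormal
system of harmonic functions: `F_ℂ` embeds into `L²_ℂ(K, ν)`, so that `∂` is a well-defined
unbounded operator on `L²_ℂ(K, ν)`, and the Dirac operator is self-adjoint. -/
theorem theorem3 (T : Affine.Triangle ℝ SierpinskiGasket.Plane) (hT : T.Equilateral)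
    (h : Fin 2 → SierpinskiGasket.energyDomain T) (hh : SierpinskiGasket.IsHarmonicONS h) :
    Function.Injective (SierpinskiGasket.toL2 h) ∧ IsSelfAdjoint (SierpinskiGasket.dirac h) := by
  exact ⟨SierpinskiGasket.toL2_injective hh, SierpinskiGasket.isSelfAdjoint_dirac
    SierpinskiGasket.dense_derivation_domain (SierpinskiGasket.isClosed_derivation hh)⟩
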